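/- **Conventions.** Let $U(1)\le SU(2)$ be the subgroup of diagonal matrices and write $e^{i\theta}=\mathrm{diag}(e^{i\theta},e^{-i\theta})$. For a connected $3$-manifold $M$ whose boundary is a torus, put $\mathcal R(\partial M)=\mathrm{Hom}(\pi_1(\partial M),U(1))$. An ordered basis $(x,h)$ of $\pi_1(\partial M)$ gives coordinates $(\theta,\psi)$ modulo $2\pi$ on $\mathcal R(\partial M)$: the point $(\theta,\psi)$ is the representation with $x\mapsto e^{i\theta}$, $h\mapsto e^{i\psi}$. Let $T(M,\partial M)$, $A(M)$, $H(M)\subset\mathcal R(\partial M)$ be the sets of those $\eta$ that extend, respectively, to some representation, to an abelian representation, and to a non-abelian (irreducible) representation $\pi_1(M)\to SU(2)$. Let $C_2$ be the circle bundle with orientable total space over the once-punctured Möbius band. Its boundary consists of two tori $\Sigma_1',\Sigma_2'$, and $$\pi_1(C_2)=\langle x_1,x_2,z,h \mid [x_1,h],\,[x_2,h],\,x_1x_2z^2,\,zhz^{-1}h\rangle,$$ where $h$ is the regular fibre and $(x_j,h)$ is an ordered basis of $\pi_1(\Sigma_j')$, which gives coordinates $(\theta_j,\psi_j)$ on $\mathcal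 R(\Sigma_j')$. Let $Y_1$ be a connected $3$-manifold with torus boundary and let $Y=Y_1\cup_{\Sigma_1'}C_2$ be a $3$-manifold obtained by identifying $\partial Y_1$ with $\Sigma_1'$ by a homeomorphism, so that $\partial Y=\Sigma_2'$. Regard $T(Y_1,\partial Y_1),A(Y_1),H(Y_1)$ as subsets of $\mathcal R(\Sigma_1')$ and $T(Y,\partial Y),A(Y),H(Y)$ as subsets of $\mathcal R(\Sigma_2')$. **Theorem.** We have $T(Y,\partial Y)=A(Y)\cup H(Y)$. Furthermore $$A(Y)=\begin{cases}\{\psi_2=0\}&\text{if }A(Y_1)\cap\{\psi_1=\pi\}=\emptyset,\\ \{\psi_2=0\}\cup\{\psi_2=\pi\}&\text{otherwise,}\end{cases}$$ and $H_{Y,t}\cup H_{Y,0}\cup H_{Y,\pi}\subseteq H(Y)$, where $$H_{Y,t}=\{(-\theta_1+\pi,\psi_1)\in\mathcal R(\Sigma_2') : (\theta_1,\psi_1)\in T(Y_1,\partial Y_1),\ \psi_1\notin\pi\mathbb Z\}$$ and, for $\varepsilon\in\{0,\pi\}$, $H_{Y,\varepsilon}\subseteq\mathcal R(\Sigma_2')$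 is given by the first case that applies in $$H_{Y,\varepsilon}=\begin{cases}\{\psi_2=\varepsilon\}&\text{if }H(Y_1)\cap\{\psi_1=\varepsilon\}\neq\emptyset,\\ \{\psi_2=\varepsilon\}\setminus\{0,\pi\}^2&\text{if }T(Y_1,\partial Y_1)\cap(\{\psi_1=\varepsilon\}\setminus\{0,\pi\}^2)\neq\emptyset,\\ \emptyset&\text{otherwise.}\end{cases}$$ -/

import Mathlib

open scoped Manifold

noncomputable section

/-! ### `SU(2)` and its diagonal subgroup `U(1)` -/

/-- The group `SU(2)`. -/
abbrev SU2 : Type := Matrix.specialUnitaryGroup (Fin 2) ℂ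

/-- `U(1)`: the subgroup of the diagonal matrices of `SU(2)`. -/
def U1 : Subgroup SU2 where
  carrier := {A | A.1.IsDiag}
  mul_mem' := by
    intro A B hA hB
    change (A.1 * B.1).IsDiag
    intro i j hij
    rw [Matrix.mul_apply]
    refine Finset.sum_eq_zero fun k _ => ?_
    by_cases h : i = k
    · subst h
      rw [hB hij, mul_zero]
    · rw [hA h, zero_mul]
  one_mem' := Matrix.isDiag_one
  inv_mem' := by
    intro A hA
    exact Matrix.IsDiag.conjTranspose hA

/-- The element `e^{iθ} = diag(e^{iθ}, e^{-iθ})` of `U(1) ≤ SU(2)`. -/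
def expU1 (θ : ℝ) : U1 :=
  ⟨⟨Matrix.diagonal ![(Circle.exp θ : ℂ), (Circle.exp (-θ) : ℂ)], by
      have h : ∀ t : ℝ, (Circle.exp t : ℂ) * (Circle.exp (-t) : ℂ) = 1 := fun t => by
        rw [← Circle.coe_mul, ← Circle.exp_add, add_neg_cancel, Circle.exp_zero, Circle.coe_one]
      have h' : ∀ t : ℝ, (Circle.exp t : ℂ) * star (Circle.exp t : ℂ) = 1 := fun t => by
        have := Complex.mul_conj (Circle.exp t : ℂ)
        rw [Circle.normSq_coe] at this
        simpa using this
      rw [Matrix.mem_specialUnitaryGroup_iff]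
      refine ⟨?_, ?_⟩
      · rw [Matrix.mem_unitaryGroup_iff, Matrix.star_eq_conjTranspose,
          Matrix.diagonal_conjTranspose, Matrix.diagonal_mul_diagonal, ← Matrix.diagonal_one]
        congr 1
        funext i
        fin_cases i
        · exact h' θ
        · exact h' (-θ)
      · rw [Matrix.det_diagonal, Fin.prod_univ_two]
        exact h θ⟩,
    Matrix.isDiag_diagonal _⟩

/-! ### The torus and its standard loops -/

/-- The standard torus `S¹ × S¹`. -/
abbrev Torus : Type := Circle × Circle

/-- The loop `t ↦ (e^{2πit}, 1)` of the standard torus, `0 ≤ t ≤ 1`. -/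
def loopX : Path ((1, 1) : Torus) (1, 1) where
  toFun t := (Circle.exp (2 * Real.pi * t), 1)
  continuous_toFun := by fun_prop
  source' := by simp
  target' := by simp

/-- The loop `t ↦ (1, e^{2πit})` of the standard torus, `0 ≤ t ≤ 1`. -/
def loopH : Path ((1, 1) : Torus) (1, 1) where
  toFun t := (1, Circle.exp (2 * Real.pi * t))
  continuous_toFun := by fun_prop
  source' := by simp
  target' := by simp

/-! ### Representations of the fundamental group relative to the boundary torus -/

section Representations

variable {M : Type*} [TopologicalSpace M] [ChartedSpace (EuclideanHalfSpace 3) M]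

variable (M) in
/-- The boundary `∂M` of a topological `3`-manifold with boundary, as a subspace. -/
abbrev Bd : Type _ := ((𝓡∂ 3).boundary M : Set M)

variable (M) in
/-- The inclusion `ι : ∂M → M`. -/
def bdIncl : C(Bd M, M) := ⟨Subtype.val, continuous_subtype_val⟩

/-- The base point, on the boundary torus, given by a parametrization `e` of `∂M`. -/
abbrev basePt (e : Torus ≃ₜ Bd M) : Bd M := (e : C(Torus, Bd M)) (1, 1)

/-- `π₁(∂M)`, based at `e (1, 1)`. -/
abbrev PiBd (e : Torus ≃ₜ Bd M) : Type _ := FundamentalGroup (Bd M) (basePt e)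

/-- `π₁(M)`, based at the same point of the boundary torus. -/
abbrev PiM (e : Torus ≃ₜ Bd M) : Type _ := FundamentalGroup M (bdIncl M (basePt e))

/-- `ι_* : π₁(∂M) → π₁(M)`. -/
def inclStar (e : Torus ≃ₜ Bd M) : PiBd e →* PiM e := FundamentalGroup.map (bdIncl M) (basePt e)

/-- The first element `x` of the ordered basis `(x, h)` of `π₁(∂M)` given by `e`. -/
def basisX (e : Torus ≃ₜ Bd M) : PiBd e :=
  FundamentalGroup.map (e : C(Torus, Bd M)) (1, 1)
    (FundamentalGroup.fromPath (Path.Homotopic.Quotient.mk loopX))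

/-- The second element `h` of the ordered basis `(x, h)` of `π₁(∂M)` given by `e`. -/
def basisH (e : Torus ≃ₜ Bd M) : PiBd e :=
  FundamentalGroup.map (e : C(Torus, Bd M)) (1, 1)
    (FundamentalGroup.fromPath (Path.Homotopic.Quotient.mk loopH))

/-- `𝓡(∂M) = Hom(π₁(∂M), U(1))`. -/
abbrev RBd (e : Torus ≃ₜ Bd M) : Type _ := PiBd e →* U1

/-- `R(M) = Hom(π₁(M), SU(2))`. -/
abbrev RM (e : Torus ≃ₜ Bd M) : Type _ := PiM e →* SU2

/-- `η ∈ 𝓡(∂M)` is the point with coordinates `(θ, ψ)` (modulo `2π`):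
`η(x) = e^{iθ}` and `η(h) = e^{iψ}`. -/
def HasCoords {e : Torus ≃ₜ Bd M} (η : RBd e) (θ ψ : ℝ) : Prop :=
  η (basisX e) = expU1 θ ∧ η (basisH e) = expU1 ψ

/-- `ρ ∈ R(M)` restricts to `η ∈ 𝓡(∂M)` on the boundary torus. -/
def Extends {e : Torus ≃ₜ Bd M} (ρ : RM e) (η : RBd e) : Prop :=
  ∀ γ : PiBd e, ρ (inclStar e γ) = (η γ : SU2)

/-- A representation is abelian if its image is commutative. -/
def IsAbelianRep {e : Torus ≃ₜ Bd M} (ρ : RM e) : Prop :=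
  ∀ a b : PiM e, ρ a * ρ b = ρ b * ρ a

/-- `T(M, ∂M)`: the representations `π₁(∂M) → U(1)` that extend to `π₁(M) → SU(2)`. -/
def TSet (e : Torus ≃ₜ Bd M) : Set (RBd e) := {η | ∃ ρ : RM e, Extends ρ η}

/-- `A(M)`: those that extend to an abelian representation. -/
def ASet (e : Torus ≃ₜ Bd M) : Set (RBd e) := {η | ∃ ρ : RM e, Extends ρ η ∧ IsAbelianRep ρ}

/-- `H(M)`: those that extend to an irreducible (that is, non-abelian) representation. -/
def HSet (e : Torus ≃ₜ Bd M) : Set (RBd e) := {η | ∃ ρ : RM e, Extends ρ η ∧ ¬ IsAbelianRep ρ}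

/-- The line `{ψ = c}` of `𝓡(∂M)`. -/
def psiLine (e : Torus ≃ₜ Bd M) (c : ℝ) : Set (RBd e) := {η | ∃ θ : ℝ, HasCoords η θ c}

/-- The four points `{0, π}²` of `𝓡(∂M)`. -/
def corners (e : Torus ≃ₜ Bd M) : Set (RBd e) :=
  {η | ∃ θ ψ : ℝ, (θ = 0 ∨ θ = Real.pi) ∧ (ψ = 0 ∨ ψ = Real.pi) ∧ HasCoords η θ ψ}

end Representations

/-! ### The manifold `C₂`

The Möbius band is `(S¹ × [-1, 1]) / ((u, t) ∼ (-u, -t))`. Remove from it the open disc of radius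
`1/2` whose two lifts to `S¹ × [-1, 1]` are centred at `(1, 0)` and `(-1, 0)`. The manifold `C₂` is
the circle bundle with orientable total space over this once-punctured Möbius band, that is, the
quotient of (double cover of the base) `× S¹` by the free, orientation preserving involution
`(u, t, w) ↦ (-u, -t, w⁻¹)`. -/

/-- The product of `S¹` with the annulus `S¹ × [-1, 1]` without the two open discs
`{(± e^{is}, t) : s² + t² < 1/4}`. -/
def C2Cover : Set (Circle × ℝ × Circle) :=
  {p | |p.2.1| ≤ 1 ∧
    ∀ s : ℝ, (p.1 = Circle.exp s ∨ p.1 = -Circle.exp s) → 1 / 4 ≤ s ^ 2 + p.2.1 ^ 2}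

/-- The orbit relation of the involution `(u, t, w) ↦ (-u, -t, w⁻¹)`. -/
def C2Setoid : Setoid C2Cover where
  r p q := q = p ∨ (q.1.1 = -p.1.1 ∧ q.1.2.1 = -p.1.2.1 ∧ q.1.2.2 = p.1.2.2⁻¹)
  iseqv :=
    { refl := fun _ => Or.inl rfl
      symm := by
        rintro p q (h | ⟨h₁, h₂, h₃⟩)
        · exact Or.inl h.symm
        · exact Or.inr ⟨by rw [h₁, neg_neg], by rw [h₂, neg_neg], by rw [h₃, inv_inv]⟩
      trans := by
        rintro p q r (rfl | ⟨h₁, h₂, h₃⟩) (rfl | ⟨k₁, k₂, k₃⟩)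
        · exact Or.inl rfl
        · exact Or.inr ⟨k₁, k₂, k₃⟩
        · exact Or.inr ⟨h₁, h₂, h₃⟩
        · refine Or.inl (Subtype.ext (Prod.ext ?_ (Prod.ext ?_ ?_)))
          · rw [k₁, h₁, neg_neg]
          · rw [k₂, h₂, neg_neg]
          · rw [k₃, h₃, inv_inv] }

/-- The manifold `C₂`, with the quotient topology. -/
def C2 : Type := Quotient C2Setoid

instance : TopologicalSpace C2 := inferInstanceAs (TopologicalSpace (Quotient C2Setoid))

theorem sigma1_mem (p : Torus) : ((p.1, 1, p.2) : Circle × ℝ × Circle) ∈ C2Cover := by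
  refine ⟨by simp, fun s _ => ?_⟩
  have := sq_nonneg s
  norm_num
  linarith

/-- The boundary torus `Σ₁'` of `C₂`, which lies over the boundary circle `t = 1` of the Möbius
band, with its parametrization. The loop `x₁` is `loopX` in this torus and the regular fibre `h₁`
is `loopH`. -/
def sigma1 (p : Torus) : C2 := Quotient.mk C2Setoid ⟨(p.1, 1, p.2), sigma1_mem p⟩

theorem sigma2_mem (p : Torus) :
    ((-Circle.exp ((p.1 : ℂ).re / 2), (p.1 : ℂ).im / 2, p.2) : Circle × ℝ × Circle)
      ∈ C2Cover := by
  have h : (p.1 : ℂ).re ^ 2 + (p.1 : ℂ).im ^ 2 = 1 := by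
    have := Circle.normSq_coe p.1
    rw [Complex.normSq_apply] at this
    nlinarith
  refine ⟨?_, fun s hs => ?_⟩
  · rw [abs_le]
    constructor <;> nlinarith [sq_nonneg (p.1 : ℂ).re]
  · have h2 : Circle.exp ((p.1 : ℂ).re) = Circle.exp (2 * s) := by
      have e1 : Circle.exp ((p.1 : ℂ).re) = (-Circle.exp ((p.1 : ℂ).re / 2)) ^ 2 := by
        rw [neg_sq, sq, ← Circle.exp_add]
        congr 1
        ring
      have e2 : Circle.exp (2 * s) = Circle.exp s ^ 2 := by
        rw [sq, ← Circle.exp_add]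
        congr 1
        ring
      rw [e1, e2]
      rcases hs with hs | hs
      · exact congrArg (· ^ 2) hs
      · rw [show -Circle.exp ((p.1 : ℂ).re / 2) = -Circle.exp s from hs, neg_sq]
    obtain ⟨n, hn⟩ := Circle.exp_eq_exp.1 h2
    have hre : |(p.1 : ℂ).re| ≤ 1 := by
      rw [abs_le]
      constructor <;> nlinarith [sq_nonneg (p.1 : ℂ).im]
    have key : (p.1 : ℂ).re ^ 2 ≤ (2 * s) ^ 2 := by
      rw [sq_le_sq]
      by_cases h0 : n = 0
      · subst h0
        rw [hn]
        simp
      · have hn1 : (1 : ℝ) ≤ |(n : ℝ)| := by exact_mod_cast Int.one_le_abs h0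
        have h3 : |(n : ℝ) * (2 * Real.pi)| ≤ |(p.1 : ℂ).re| + |2 * s| := by
          rw [show (n : ℝ) * (2 * Real.pi) = (p.1 : ℂ).re - 2 * s by rw [hn]; ring]
          exact abs_sub _ _
        rw [abs_mul, abs_of_pos Real.two_pi_pos] at h3
        nlinarith [Real.pi_gt_three]
    change 1 / 4 ≤ s ^ 2 + ((p.1 : ℂ).im / 2) ^ 2
    nlinarith

/-- The boundary torus `Σ₂'` of `C₂`, which lies over the boundary circle of the removed disc, with
its parametrization. The loop `x₂` is `loopX` in this torus and the regular fibre `h₂` is `loopH`.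

With `x₁, h` in `Σ₁'`, and `x₂, h` carried from `Σ₂'` to the same base point along a suitable path,
`π₁(C₂) = ⟨x₁, x₂, z, h | [x₁, h], [x₂, h], x₁ x₂ z², z h z⁻¹ h⟩`, where `z` projects to a core of
the Möbius band. -/
def sigma2 (p : Torus) : C2 :=
  Quotient.mk C2Setoid
    ⟨(-Circle.exp ((p.1 : ℂ).re / 2), (p.1 : ℂ).im / 2, p.2), sigma2_mem p⟩

/-! ### The manifold `Y = Y₁ ∪ C₂` -/

/-- A decomposition `Y = Y₁ ∪ C₂` along the torus `Σ₁'`: closed embeddings of `Y₁` and of `C₂` in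
`Y` which cover `Y` and whose images meet exactly in `∂Y₁ = Σ₁'`, so that `∂Y = Σ₂'`. The tori `∂Y₁`
and `∂Y` are parametrized as `Σ₁'` and `Σ₂'` are. -/
structure UnionC2 (Y₁ Y : Type*) [TopologicalSpace Y₁] [ChartedSpace (EuclideanHalfSpace 3) Y₁]
    [TopologicalSpace Y] [ChartedSpace (EuclideanHalfSpace 3) Y] where
  /-- the inclusion of `Y₁` -/
  j : Y₁ → Y
  /-- the inclusion of `C₂` -/
  k : C2 → Y
  isClosedEmbedding_j : Topology.IsClosedEmbedding j
  isClosedEmbedding_k : Topology.IsClosedEmbedding k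
  cover : Set.range j ∪ Set.range k = Set.univ
  inter : Set.range j ∩ Set.range k = k '' Set.range sigma1
  /-- the identification of `Σ₁'` with `∂Y₁` -/
  e₁ : Torus ≃ₜ Bd Y₁
  j_e₁ : ∀ p : Torus, j (e₁ p) = k (sigma1 p)
  /-- the identification of `Σ₂'` with `∂Y` -/
  e₂ : Torus ≃ₜ Bd Y
  coe_e₂ : ∀ p : Torus, (e₂ p : Y) = k (sigma2 p)

namespace UnionC2

variable {Y₁ Y : Type*} [TopologicalSpace Y₁] [ChartedSpace (EuclideanHalfSpace 3) Y₁]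
  [TopologicalSpace Y] [ChartedSpace (EuclideanHalfSpace 3) Y]

/-- `H_{Y,t}`: the points `(π - θ₁, ψ₁)` of `𝓡(Σ₂')` such that `(θ₁, ψ₁) ∈ T(Y₁, ∂Y₁)` and
`ψ₁ ∉ πℤ`. -/
def Ht (D : UnionC2 Y₁ Y) : Set (RBd D.e₂) :=
  {η | ∃ η₁ ∈ TSet D.e₁, ∃ θ₁ ψ₁ : ℝ, HasCoords η₁ θ₁ ψ₁ ∧ (∀ n : ℤ, ψ₁ ≠ n * Real.pi) ∧
    HasCoords η (-θ₁ + Real.pi) ψ₁}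

open Classical in
/-- `H_{Y,ε}`, to be used for `ε ∈ {0, π}`. -/
def Heps (D : UnionC2 Y₁ Y) (ε : ℝ) : Set (RBd D.e₂) :=
  if (HSet D.e₁ ∩ psiLine D.e₁ ε).Nonempty then psiLine D.e₂ ε
  else if (TSet D.e₁ ∩ (psiLine D.e₁ ε \ corners D.e₁)).Nonempty then
    psiLine D.e₂ ε \ corners D.e₂
  else ∅

end UnionC2

end

noncomputable section

/-! ### Flat transports -/

/-! The manifold C₂ matters only through a one-parameter gluing rule. If a representation ρ₁ of
π₁(Y₁) sends x₁, h to commuting elements X₁, H, then every W with W H W⁻¹ = H⁻¹ (the value of z⁻¹,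
up to the choice of base path) gives a representation of π₁(Y) with h ↦ H and x₂ ↦ W² X₁⁻¹, and its
image contains X₁⁻¹ ρ₁ X₁: this is `UnionC2.exists_hom`. In the other direction, along an
orientation reversing loop of the Möbius band the fibre returns inverted, so a representation with
commuting values has H² = 1 and takes the same value on the fibres of Σ₁' and Σ₂'
(`UnionC2.exists_hom_of_commute`).

The theorem is then a matter of choosing W in SU(2). For A(Y): H² = 1 forces ψ₂ ∈ {0, π}. The
restriction to Y₁ is conjugate into U(1), and the central value H = ±1 survives the conjugation.
Conversely, if ρ₁ has values in U(1) and H = ±1, a diagonal W gives W² X₁⁻¹ any value in U(1). For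
H_{Y,t}: the quaternion j inverts U(1) and has square -1. The result is irreducible because H² ≠ 1.
For H_{Y,ε}: H = ±1 is central, so W is arbitrary. If ρ₁ is irreducible, a diagonal W suffices. If
only X₁ ≠ ±1 is known, x₂ is sent to a conjugate of e^{iθ} that does not commute with X₁, which is
possible because every element of SU(2) has a square root (`SU2.exists_sqrt`).

The gluing rule is proved with flat transports, functions on paths that are multiplicative on filled
triangles, in place of group presentations. They correspond to representations of the fundamental
groupoid, and they glue over open covers (`exists_flatOn_univ_of_agree`, a van Kampen theorem). On
C₂ they come from trivializations over six charts with locally constant transition functions. On Y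
they are glued along Σ₁', after a collar of Σ₁' inside C₂ has been collapsed. -/

/-- The straight segment from `p` to `q`, parametrized by the unit interval. -/
def segmentMap {E : Type*} [AddCommGroup E] [Module ℝ E] (p q : E) : unitInterval → E :=
  fun t => AffineMap.lineMap p q (t : ℝ)

section SegmentMap

variable {E : Type*} [AddCommGroup E] [Module ℝ E]

@[simp] theorem segmentMap_zero (p q : E) : segmentMap p q 0 = p := by simp [segmentMap]

@[simp] theorem segmentMap_one (p q : E) : segmentMap p q 1 = q := by simp [segmentMap]

theorem segmentMap_self (p : E) : segmentMap p p = fun _ => p := by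
  funext t; simp [segmentMap]

theorem segmentMap_mem {s : Set E} (hs : Convex ℝ s) {p q : E} (hp : p ∈ s) (hq : q ∈ s)
    (t : unitInterval) : segmentMap p q t ∈ s :=
  hs.lineMap_mem hp hq t.2

theorem continuous_segmentMap [TopologicalSpace E] [IsTopologicalAddGroup E]
    [ContinuousSMul ℝ E] (p q : E) : Continuous (segmentMap p q) :=
  AffineMap.lineMap_continuous.comp continuous_subtype_val

theorem continuous_comp_segmentMap [TopologicalSpace E] [IsTopologicalAddGroup E]
    [ContinuousSMul ℝ E] {X : Type*} [TopologicalSpace X] {F : E → X} {s : Set E}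
    (hs : Convex ℝ s) (hF : ContinuousOn F s) {p q : E} (hp : p ∈ s) (hq : q ∈ s) :
    Continuous (F ∘ segmentMap p q) :=
  hF.comp_continuous (continuous_segmentMap p q) (segmentMap_mem hs hp hq)

theorem segmentMap_zero_left (a : ℝ) (t : unitInterval) : segmentMap 0 a t = a * t := by
  simp [segmentMap, AffineMap.lineMap_apply, mul_comm]

end SegmentMap

/-- A function `v` on paths is a flat transport over `U` if it is multiplicative on the boundary
of every triangle that is filled in `U`. Products are read from right to left. -/
def FlatOn {X G : Type*} [TopologicalSpace X] [Group G] (U : Set X)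
    (v : (unitInterval → X) → G) : Prop :=
  ∀ (F : ℝ × ℝ → X) (s : Set (ℝ × ℝ)), Convex ℝ s → ContinuousOn F s → Set.MapsTo F s U →
    ∀ p ∈ s, ∀ q ∈ s, ∀ r ∈ s,
      v (F ∘ segmentMap q r) * v (F ∘ segmentMap p q) = v (F ∘ segmentMap p r)

namespace FlatOn

variable {X Y G : Type*} [TopologicalSpace X] [TopologicalSpace Y] [Group G]
  {U : Set X} {v : (unitInterval → X) → G}

theorem comp {V : Set Y} {v : (unitInterval → Y) → G} (hv : FlatOn V v) {g : X → Y}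
    (hg : ContinuousOn g U) (hm : Set.MapsTo g U V) : FlatOn U (fun γ => v (g ∘ γ)) :=
  fun F s hs hF hFm => hv (g ∘ F) s hs (hg.comp hF hFm) (hm.comp hFm)

/-- The transport of a trivial local system. Continuity of `f` plays no role: `f` is a mere choice
of trivialization at each point. -/
theorem of_fun (f : X → G) : FlatOn U (fun γ => f (γ 1) * (f (γ 0))⁻¹) :=
  fun F s _ _ _ p _ q _ r _ => by simp

theorem gauge (hv : FlatOn U v) (f : X → G) :
    FlatOn U (fun γ => f (γ 1) * v γ * (f (γ 0))⁻¹) :=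
  fun F s hs hF hm p hp q hq r hr => by
    simp only [Function.comp_apply, segmentMap_one, segmentMap_zero]
    rw [← hv F s hs hF hm p hp q hq r hr]
    group

theorem const (hv : FlatOn U v) {x : X} (hx : x ∈ U) : v (fun _ => x) = 1 := by
  have h := hv (fun _ => x) Set.univ convex_univ continuousOn_const (fun _ _ => hx)
    0 trivial 0 trivial 0 trivial
  exact mul_eq_left.1 h

/-- Multiplicativity along the subdivision of a path. -/
theorem interval (hv : FlatOn U v) {γ : ℝ → X} {s : Set ℝ} (hs : Convex ℝ s)
    (hγ : ContinuousOn γ s) (hm : Set.MapsTo γ s U) {a b c : ℝ} (ha : a ∈ s) (hb : b ∈ s)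
    (hc : c ∈ s) :
    v (γ ∘ segmentMap b c) * v (γ ∘ segmentMap a b) = v (γ ∘ segmentMap a c) := by
  have key : ∀ a b : ℝ, (γ ∘ Prod.fst) ∘ segmentMap (a, (0 : ℝ)) (b, (0 : ℝ))
      = γ ∘ segmentMap a b := by
    intro a b
    funext t
    simp [segmentMap, AffineMap.lineMap_apply]
  have h := hv (γ ∘ Prod.fst) (s ×ˢ Set.univ) (hs.prod convex_univ)
    (hγ.comp continuousOn_fst fun p hp => hp.1) (fun p hp => hm hp.1)
    (a, 0) ⟨ha, trivial⟩ (b, 0) ⟨hb, trivial⟩ (c, 0) ⟨hc, trivial⟩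
  rwa [key, key, key] at h

/-- Flatness on the boundary of a square. -/
theorem square (hv : FlatOn U v) {F : ℝ × ℝ → X}
    (hF : ContinuousOn F (Set.Icc 0 1 ×ˢ Set.Icc 0 1))
    (hm : Set.MapsTo F (Set.Icc 0 1 ×ˢ Set.Icc 0 1) U) :
    v (fun t => F (1, t)) * v (fun t => F (t, 0)) =
      v (fun t => F (t, 1)) * v (fun t => F (0, t)) := by
  have hs : Convex ℝ (Set.Icc (0 : ℝ) 1 ×ˢ Set.Icc (0 : ℝ) 1) :=
    (convex_Icc 0 1).prod (convex_Icc 0 1)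
  have h0 : (0 : ℝ) ∈ Set.Icc (0 : ℝ) 1 := by simp
  have h1 : (1 : ℝ) ∈ Set.Icc (0 : ℝ) 1 := by simp
  -- The two triangles of the square share the diagonal from (0, 0) to (1, 1).
  have e1 := hv F _ hs hF hm (0, 0) ⟨h0, h0⟩ (1, 0) ⟨h1, h0⟩ (1, 1) ⟨h1, h1⟩
  have e2 := hv F _ hs hF hm (0, 0) ⟨h0, h0⟩ (0, 1) ⟨h0, h1⟩ (1, 1) ⟨h1, h1⟩
  rw [← e2] at e1
  have k : ∀ a b c d : ℝ, F ∘ segmentMap (a, b) (c, d) =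
      fun t : unitInterval => F (AffineMap.lineMap a c (t : ℝ), AffineMap.lineMap b d (t : ℝ)) := by
    intro a b c d
    funext t
    simp [segmentMap, AffineMap.lineMap_apply]
  simpa [k, AffineMap.lineMap_apply] using e1

/-- Flatness on the square filled by the homotopy; the two sides on which the end points stay fixed
contribute 1. -/
theorem homotopic (hv : FlatOn Set.univ v) {x y : X} {γ δ : Path x y} (h : γ.Homotopic δ) :
    v γ = v δ := by
  obtain ⟨H⟩ := h
  let π : ℝ → unitInterval := Set.projIcc 0 1 zero_le_one
  have hπ : Continuous π := continuous_projIcc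
  have hπ' : ∀ t : unitInterval, π t = t := fun t => Set.projIcc_val _ t
  have e := hv.square (F := fun p => H (π p.2, π p.1)) (by fun_prop) (fun _ _ => trivial)
  have π0 : π 0 = 0 := Set.projIcc_left _
  have π1 : π 1 = 1 := Set.projIcc_right _
  simp only [hπ', π0, π1, ContinuousMap.HomotopyWith.apply_zero,
    ContinuousMap.HomotopyWith.apply_one, Path.Homotopy.source, Path.Homotopy.target,
    hv.const (Set.mem_univ _)] at e
  rw [one_mul, mul_one] at e
  exact e

theorem trans (hv : FlatOn Set.univ v) {x y z : X} (γ : Path x y) (δ : Path y z) :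
    v (γ.trans δ) = v δ * v γ := by
  have h := hv.interval convex_univ (γ.trans δ).continuous_extend.continuousOn
    (fun _ _ => trivial) (Set.mem_univ 0) (Set.mem_univ (1 / 2)) (Set.mem_univ 1)
  have e0 : (γ.trans δ).extend ∘ segmentMap 0 1 = γ.trans δ := by
    funext t
    simp [segmentMap, AffineMap.lineMap_apply]
  have e1 : (γ.trans δ).extend ∘ segmentMap 0 (1 / 2) = γ := by
    funext t
    have ht := t.2
    simp only [segmentMap, AffineMap.lineMap_apply, Function.comp_apply, vsub_eq_sub, smul_eq_mul,
      vadd_eq_add]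
    rw [Path.extend_apply _ ⟨by linarith [ht.1], by linarith [ht.2]⟩, Path.trans_apply,
      dif_pos (by simp; linarith [ht.2])]
    congr 1
    ext
    simp
    ring
  have e2 : (γ.trans δ).extend ∘ segmentMap (1 / 2) 1 = δ := by
    funext t
    have ht := t.2
    simp only [segmentMap, AffineMap.lineMap_apply, Function.comp_apply, vsub_eq_sub, smul_eq_mul,
      vadd_eq_add]
    rw [Path.extend_apply _ ⟨by linarith [ht.1], by linarith [ht.2]⟩]
    by_cases h0 : (t : ℝ) = 0
    · obtain rfl : t = 0 := Subtype.ext h0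
      rw [Path.trans_apply, dif_pos (by norm_num)]
      simp
    · have : 0 < (t : ℝ) := lt_of_le_of_ne ht.1 (Ne.symm h0)
      rw [Path.trans_apply, dif_neg (by simp only [not_le]; linarith)]
      congr 1
      ext
      simp
      ring
  rw [e0, e1, e2] at h
  exact h.symm

theorem symm (hv : FlatOn Set.univ v) {x y : X} (γ : Path x y) : v γ.symm = (v γ)⁻¹ := by
  refine eq_inv_of_mul_eq_one_left ?_
  rw [← hv.trans, hv.homotopic (Path.Homotopic.trans_symm γ)]
  exact hv.const (Set.mem_univ x)

/-- The representation of the fundamental group given by a flat transport. -/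
def hom (hv : FlatOn Set.univ v) (x : X) : FundamentalGroup X x →* G where
  toFun p := Quotient.lift (fun γ : Path x x => v γ) (fun _ _ h => hv.homotopic h) p
  map_one' := hv.const (Set.mem_univ x)
  map_mul' := by
    rintro ⟨p⟩ ⟨q⟩
    -- In `FundamentalGroup`, as in `FlatOn`, the right factor of a product is traversed first.
    exact hv.trans q p

theorem hom_mk (hv : FlatOn Set.univ v) {x : X} (γ : Path x x) :
    hv.hom x (FundamentalGroup.fromPath (Path.Homotopic.Quotient.mk γ)) = v γ := rfl

end FlatOn

/-! ### Transports from representations of the fundamental group -/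

open Classical in
/-- A path from `x` to each point of its path component. -/
def basePathTo {X : Type*} [TopologicalSpace X] (x y : X) (h : Joined x y) : Path x y :=
  if e : x = y then (Path.refl x).cast rfl e.symm else h.somePath

open Classical in
/-- The transport given by a representation of the fundamental group; it is trivial outside the
path component of the base point. -/
def transportOf {X G : Type*} [TopologicalSpace X] [Group G] {x : X}
    (ρ : FundamentalGroup X x →* G) (γ : unitInterval → X) : G :=
  if h : Continuous γ ∧ Joined x (γ 0) ∧ Joined x (γ 1) then
    ρ (FundamentalGroup.fromPath (Path.Homotopic.Quotient.mk
      (((basePathTo x (γ 0) h.2.1).trans ⟨⟨γ, h.1⟩, rfl, rfl⟩).trans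
        (basePathTo x (γ 1) h.2.2).symm)))
  else 1

theorem transportOf_eq {X G : Type*} [TopologicalSpace X] [Group G] {x : X}
    (ρ : FundamentalGroup X x →* G) {γ : unitInterval → X} {u w : X} (hu : γ 0 = u) (hw : γ 1 = w)
    (hγ : Continuous γ) (ju : Joined x u) (jw : Joined x w) :
    transportOf ρ γ = ρ (FundamentalGroup.fromPath (Path.Homotopic.Quotient.mk
      (((basePathTo x u ju).trans ⟨⟨γ, hγ⟩, hu, hw⟩).trans (basePathTo x w jw).symm))) := by
  subst hu hw
  rw [transportOf, dif_pos ⟨hγ, ju, jw⟩]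

/-- A convex set is simply connected, so the triangle bounds, and the auxiliary base paths cancel at
the middle vertex. The image of `s` lies in one path component; if that is not the component of `x`,
all three values are 1. -/
theorem flatOn_transportOf {X G : Type*} [TopologicalSpace X] [Group G] {x : X}
    (ρ : FundamentalGroup X x →* G) : FlatOn Set.univ (transportOf ρ) := by
  intro F s hs hF _ p hp q hq r hr
  have hc : ∀ a ∈ s, ∀ b ∈ s, Continuous (F ∘ segmentMap a b) := fun a ha b hb =>
    continuous_comp_segmentMap hs hF ha hb
  have hj : ∀ a ∈ s, ∀ b ∈ s, Joined (F a) (F b) := fun a ha b hb =>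
    ⟨⟨⟨_, hc a ha b hb⟩, by simp, by simp⟩⟩
  by_cases hx : Joined x (F p)
  · have hxa : ∀ a ∈ s, Joined x (F a) := fun a ha => hx.trans (hj p hp a ha)
    let P : ∀ a ∈ s, ∀ b ∈ s, Path (F a) (F b) := fun a ha b hb =>
      ⟨⟨_, hc a ha b hb⟩, by simp, by simp⟩
    have key : ∀ a (ha : a ∈ s) b (hb : b ∈ s), transportOf ρ (F ∘ segmentMap a b) =
        ρ (FundamentalGroup.fromPath (Path.Homotopic.Quotient.mk
          (((basePathTo x (F a) (hxa a ha)).trans (P a ha b hb)).trans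
            (basePathTo x (F b) (hxa b hb)).symm))) := by
      intro a ha b hb
      have h0 : (F ∘ segmentMap a b) 0 = F a := by simp
      have h1 : (F ∘ segmentMap a b) 1 = F b := by simp
      exact transportOf_eq ρ h0 h1 (hc a ha b hb) _ _
    have tri : (Path.Homotopic.Quotient.mk (P p hp q hq)).trans
        (Path.Homotopic.Quotient.mk (P q hq r hr)) = Path.Homotopic.Quotient.mk (P p hp r hr) := by
      have : ContractibleSpace s := hs.contractibleSpace ⟨p, hp⟩
      let Q : ∀ a b : s, Path a b := fun a b =>
        ⟨⟨fun t => ⟨segmentMap a.1 b.1 t, segmentMap_mem hs a.2 b.2 t⟩,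
          (continuous_segmentMap _ _).subtype_mk _⟩, by ext1; simp, by ext1; simp⟩
      have hQ := SimplyConnectedSpace.paths_homotopic
        ((Q ⟨p, hp⟩ ⟨q, hq⟩).trans (Q ⟨q, hq⟩ ⟨r, hr⟩)) (Q ⟨p, hp⟩ ⟨r, hr⟩)
      have := hQ.map ⟨s.domRestrict F, hF.domRestrict⟩
      rw [← Path.Homotopic.Quotient.mk_trans]
      refine Path.Homotopic.Quotient.eq.2 ?_
      rw [Path.map_trans] at this
      exact this
    rw [key p hp q hq, key q hq r hr, key p hp r hr, ← map_mul, FundamentalGroup.mul_def]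
    congr 1
    simp only [Path.Homotopic.Quotient.mk_trans, Path.Homotopic.Quotient.mk_symm,
      ← tri]
    change ((_ : Path.Homotopic.Quotient _ _).trans _) = _
    simp only [Path.Homotopic.Quotient.trans_assoc]
    congr 2
    rw [← Path.Homotopic.Quotient.trans_assoc, Path.Homotopic.Quotient.symm_trans,
      Path.Homotopic.Quotient.refl_trans]
  · have hxa : ∀ a ∈ s, ¬ Joined x (F a) := fun a ha h => hx (h.trans (hj a ha p hp))
    have key : ∀ a ∈ s, ∀ b, transportOf ρ (F ∘ segmentMap a b) = 1 := by
      intro a ha b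
      refine dif_neg fun h => hxa a ha ?_
      simpa using h.2.1
    rw [key p hp, key q hq, key p hp, one_mul]

/-- No conjugation appears because `basePathTo` is the constant path at the base point. -/
theorem transportOf_path {X G : Type*} [TopologicalSpace X] [Group G] {x : X}
    (ρ : FundamentalGroup X x →* G) (γ : Path x x) :
    transportOf ρ γ = ρ (FundamentalGroup.fromPath (Path.Homotopic.Quotient.mk γ)) := by
  rw [transportOf_eq ρ γ.source γ.target γ.continuous (Joined.refl x) (Joined.refl x)]
  congr 1
  have : basePathTo x x (Joined.refl x) = Path.refl x := by
    rw [basePathTo, dif_pos rfl]; rfl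
  rw [this]
  change Path.Homotopic.Quotient.mk _ = Path.Homotopic.Quotient.mk _
  simp only [Path.Homotopic.Quotient.mk_trans, Path.Homotopic.Quotient.mk_symm,
    Path.Homotopic.Quotient.mk_refl, Path.Homotopic.Quotient.refl_trans]
  have : (Path.Homotopic.Quotient.refl x).symm = Path.Homotopic.Quotient.refl x := by
    rw [← Path.Homotopic.Quotient.mk_refl, ← Path.Homotopic.Quotient.mk_symm, Path.refl_symm]
  rw [this, Path.Homotopic.Quotient.trans_refl]
  rfl

theorem transportOf_mem_range {X G : Type*} [TopologicalSpace X] [Group G] {x : X}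
    (ρ : FundamentalGroup X x →* G) (γ : unitInterval → X) : transportOf ρ γ ∈ ρ.range := by
  unfold transportOf
  split_ifs
  · exact ⟨_, rfl⟩
  · exact one_mem _

/-! ### Gluing of flat transports -/

/-- The restriction of a path to `[a, b] ⊆ [0, 1]`. -/
def subpathMap {X : Type*} (γ : unitInterval → X) (a b : ℝ) : unitInterval → X :=
  fun t => γ (Set.projIcc 0 1 zero_le_one (AffineMap.lineMap a b (t : ℝ)))

/-- The product of the values of `w` on the first `k` of the `N` equal pieces of a path. -/
def chainProd {X G : Type*} [Group G] (w : (unitInterval → X) → G) (γ : unitInterval → X) (N : ℕ) :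
    ℕ → G
  | 0 => 1
  | k + 1 => w (subpathMap γ (k / N) ((k + 1) / N)) * chainProd w γ N k

theorem subpathMap_comp_segmentMap {E : Type*} [AddCommGroup E] [Module ℝ E] {X : Type*}
    (F : E → X) (x y : E)
    {a b : ℝ} (ha : a ∈ Set.Icc (0 : ℝ) 1) (hb : b ∈ Set.Icc (0 : ℝ) 1) :
    subpathMap (F ∘ segmentMap x y) a b =
      F ∘ segmentMap (AffineMap.lineMap x y a) (AffineMap.lineMap x y b) := by
  funext t
  simp only [subpathMap, segmentMap, Function.comp_apply]
  rw [Set.projIcc_of_mem _ ((convex_Icc (0 : ℝ) 1).lineMap_mem ha hb t.2),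
    AffineMap.apply_lineMap]

section Gluing

variable {X G : Type*} [Group G]

theorem div_mem_Icc_zero_one {k N : ℕ} (h : k ≤ N) : (k : ℝ) / N ∈ Set.Icc (0 : ℝ) 1 :=
  ⟨by positivity, div_le_one_of_le₀ (by exact_mod_cast h) (by positivity)⟩

theorem chainProd_succ_segmentMap {E : Type*} [AddCommGroup E] [Module ℝ E]
    (w : (unitInterval → X) → G) (F : E → X) (x y : E) {k N : ℕ} (h : k < N) :
    chainProd w (F ∘ segmentMap x y) N (k + 1) =
      w (F ∘ segmentMap (AffineMap.lineMap x y ((k : ℝ) / N))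
        (AffineMap.lineMap x y (((k + 1 : ℕ) : ℝ) / N))) *
        chainProd w (F ∘ segmentMap x y) N k := by
  rw [chainProd, ← subpathMap_comp_segmentMap F x y (div_mem_Icc_zero_one h.le)
    (div_mem_Icc_zero_one h), Nat.cast_succ]

theorem chainProd_eq_of_forall {E : Type*} [AddCommGroup E] [Module ℝ E]
    (w : (unitInterval → X) → G) (F : E → X) (x y : E) {N : ℕ} (hN : 0 < N) (D : E → G)
    (h : ∀ k < N, w (F ∘ segmentMap (AffineMap.lineMap x y ((k : ℝ) / N))
        (AffineMap.lineMap x y (((k + 1 : ℕ) : ℝ) / N))) =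
      D (AffineMap.lineMap x y (((k + 1 : ℕ) : ℝ) / N)) *
        (D (AffineMap.lineMap x y ((k : ℝ) / N)))⁻¹) :
    chainProd w (F ∘ segmentMap x y) N N = D y * (D x)⁻¹ := by
  have key : ∀ k ≤ N, chainProd w (F ∘ segmentMap x y) N k =
      D (AffineMap.lineMap x y ((k : ℝ) / N)) * (D x)⁻¹ := by
    intro k
    induction k with
    | zero => intro _; simp [chainProd]
    | succ k ih =>
      intro hk
      rw [chainProd_succ_segmentMap w F x y hk, ih (Nat.le_of_succ_le hk), h k hk]
      group
  rw [key N le_rfl, div_self (by positivity), AffineMap.lineMap_apply_one]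

variable [TopologicalSpace X]

/-- A transport that is flat over the members of an open cover has a development over every
compact convex set. -/
theorem exists_development {ι : Type*} {U : ι → Set X} (hU : ∀ i, IsOpen (U i))
    (hcov : ⋃ i, U i = Set.univ) {w : (unitInterval → X) → G} (hw : ∀ i, FlatOn (U i) w)
    {F : ℝ × ℝ → X} {s : Set (ℝ × ℝ)} (hs : Convex ℝ s) (hsc : IsCompact s)
    (hF : ContinuousOn F s) :
    ∃ D : ℝ × ℝ → G, ∀ x ∈ s, ∀ y ∈ s, ∀ᶠ M : ℕ in Filter.atTop,
      chainProd w (F ∘ segmentMap x y) M M = D y * (D x)⁻¹ := by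
  rcases s.eq_empty_or_nonempty with rfl | ⟨p, hp⟩
  · exact ⟨1, by simp⟩
  obtain ⟨δ, hδ, hleb⟩ : ∃ δ > 0, ∀ x ∈ s, ∃ i, ∀ y ∈ s, dist y x < δ → F y ∈ U i := by
    have := isCompact_iff_compactSpace.1 hsc
    obtain ⟨δ, hδ, h⟩ := lebesgue_number_lemma_of_metric (isCompact_univ (X := s))
      (c := fun i => s.domRestrict F ⁻¹' U i)
      (fun i => (hU i).preimage hF.domRestrict)
      (fun x _ => by
        have : F x ∈ ⋃ i, U i := hcov ▸ Set.mem_univ _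
        simpa using this)
    refine ⟨δ, hδ, fun x hx => ?_⟩
    obtain ⟨i, hi⟩ := h ⟨x, hx⟩ trivial
    exact ⟨i, fun y hy hyx => hi (show (⟨y, hy⟩ : s) ∈ Metric.ball ⟨x, hx⟩ δ from hyx)⟩
  have coc : ∀ c ∈ s, ∀ x ∈ s, ∀ y ∈ s, ∀ z ∈ s, dist x c < δ → dist y c < δ → dist z c < δ →
      w (F ∘ segmentMap y z) * w (F ∘ segmentMap x y) = w (F ∘ segmentMap x z) := by
    intro c hc x hx y hy z hz h1 h2 h3
    obtain ⟨i, hi⟩ := hleb c hc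
    exact hw i F (s ∩ Metric.ball c δ) (hs.inter (convex_ball c δ))
      (hF.mono Set.inter_subset_left) (fun q hq => hi q hq.1 hq.2) x ⟨hx, h1⟩ y ⟨hy, h2⟩ z ⟨hz, h3⟩
  obtain ⟨B, hB⟩ := hsc.isBounded.exists_pos_norm_le
  have hdist : ∀ x ∈ s, ∀ y ∈ s, dist x y ≤ 2 * B := fun x hx y hy => by
    rw [dist_eq_norm]
    linarith [norm_sub_le x y, hB.2 x hx, hB.2 y hy]
  obtain ⟨N, hN⟩ := exists_nat_gt (2 * B / (δ / 2))
  have hN0 : 0 < N := by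
    have : (0 : ℝ) < N := lt_trans (div_pos (by linarith [hB.1]) (by linarith)) hN
    exact_mod_cast this
  have step : ∀ M : ℕ, N ≤ M → ∀ x ∈ s, ∀ y ∈ s, ∀ k : ℕ,
      dist (AffineMap.lineMap x y (((k + 1 : ℕ) : ℝ) / M) : ℝ × ℝ)
        (AffineMap.lineMap x y ((k : ℝ) / M)) < δ / 2 := by
    intro M hM x hx y hy k
    have hM0 : (0 : ℝ) < M := by exact_mod_cast hN0.trans_le hM
    rw [dist_lineMap_lineMap, Real.dist_eq, show ((k + 1 : ℕ) : ℝ) / M - (k : ℝ) / M = 1 / M by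
      push_cast; ring, abs_of_pos (by positivity)]
    have h1 : 2 * B < M * (δ / 2) := by
      rw [div_lt_iff₀ (by linarith)] at hN
      have : (N : ℝ) ≤ M := by exact_mod_cast hM
      nlinarith
    rw [one_div, inv_mul_lt_iff₀ hM0]
    linarith [hdist x hx y hy]
  have mem : ∀ M : ℕ, ∀ x ∈ s, ∀ y ∈ s, ∀ k : ℕ, k ≤ M →
      (AffineMap.lineMap x y ((k : ℝ) / M) : ℝ × ℝ) ∈ s := fun M x hx y hy k hk =>
    hs.lineMap_mem hx hy (div_mem_Icc_zero_one hk)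
  -- The development from `p`: the product along the segment to `x`, cut into `N` pieces shorter
  -- than δ / 2.
  let D : ℝ × ℝ → G := fun x => chainProd w (F ∘ segmentMap p x) N N
  have hD : ∀ x ∈ s, ∀ y ∈ s, dist y x < δ / 2 → w (F ∘ segmentMap x y) = D y * (D x)⁻¹ := by
    intro x hx y hy hxy
    have near : ∀ k ≤ N, dist (AffineMap.lineMap p y ((k : ℝ) / N) : ℝ × ℝ)
        (AffineMap.lineMap p x ((k : ℝ) / N)) < δ / 2 := by
      intro k hk
      have hk' := div_mem_Icc_zero_one hk
      have e : (AffineMap.lineMap p y ((k : ℝ) / N) : ℝ × ℝ) - AffineMap.lineMap p x ((k : ℝ) / N)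
          = ((k : ℝ) / N) • (y - x) := by
        simp only [AffineMap.lineMap_apply, vsub_eq_sub, vadd_eq_add]
        module
      rw [dist_eq_norm, e, norm_smul, Real.norm_of_nonneg hk'.1, ← dist_eq_norm]
      nlinarith [hk'.2, hk'.1, dist_nonneg (x := y) (y := x)]
    -- A ladder between the segments to `x` and to `y`. Each cell lies within δ of its corner
    -- `lineMap p x (k / N)`, where `w` is multiplicative.
    have key : ∀ k ≤ N, w (F ∘ segmentMap (AffineMap.lineMap p x ((k : ℝ) / N))
        (AffineMap.lineMap p y ((k : ℝ) / N))) * chainProd w (F ∘ segmentMap p x) N k =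
        chainProd w (F ∘ segmentMap p y) N k := by
      intro k
      induction k with
      | zero =>
        intro _
        obtain ⟨i, hi⟩ := hleb p hp
        have : w (fun _ => F p) = 1 :=
          (hw i).const (hi p hp (by rwa [dist_self]))
        simp [chainProd, segmentMap_self]
        exact this
      | succ k ih =>
        intro hk
        have hk' := Nat.le_of_succ_le hk
        rw [chainProd_succ_segmentMap w F p x hk, chainProd_succ_segmentMap w F p y hk, ← ih hk']
        have a1 := mem N p hp x hx k hk'
        have a2 := mem N p hp x hx (k + 1) hk
        have b1 := mem N p hp y hy k hk'
        have b2 := mem N p hp y hy (k + 1) hk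
        have d1 := step N le_rfl p hp x hx k
        have d2 := step N le_rfl p hp y hy k
        have n1 := near k hk'
        have tri := dist_triangle (AffineMap.lineMap p y (((k + 1 : ℕ) : ℝ) / N) : ℝ × ℝ)
          (AffineMap.lineMap p y ((k : ℝ) / N)) (AffineMap.lineMap p x ((k : ℝ) / N))
        rw [← mul_assoc, ← mul_assoc, coc _ a1 _ a1 _ a2 _ b2 (by simpa using hδ) (by linarith)
          (by linarith), coc _ a1 _ a1 _ b1 _ b2 (by simpa using hδ) (by linarith) (by linarith)]
    have := key N le_rfl
    rw [div_self (by positivity), AffineMap.lineMap_apply_one, AffineMap.lineMap_apply_one] at this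
    exact eq_mul_inv_of_mul_eq this
  refine ⟨D, fun x hx y hy => ?_⟩
  filter_upwards [Filter.eventually_ge_atTop N] with M hM
  refine chainProd_eq_of_forall w F x y (hN0.trans_le hM) D fun k hk => ?_
  exact hD _ (mem M x hx y hy k hk.le) _ (mem M x hx y hy (k + 1) hk) (step M hM x hx y hy k)

/-- A transport that is flat over the members of an open cover extends to a flat transport. -/
theorem exists_flatOn_univ_of_cover {ι : Type*} {U : ι → Set X} (hU : ∀ i, IsOpen (U i))
    (hcov : ⋃ i, U i = Set.univ) {w : (unitInterval → X) → G} (hw : ∀ i, FlatOn (U i) w) :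
    ∃ v : (unitInterval → X) → G, FlatOn Set.univ v ∧
      ∀ i γ, Continuous γ → (∀ t, γ t ∈ U i) → v γ = w γ := by
  classical
  -- The value at which the products over finer and finer subdivisions stabilize; 1 is a junk value
  -- where they do not.
  let v : (unitInterval → X) → G := fun γ =>
    if h : ∃ c, ∀ᶠ N : ℕ in Filter.atTop, chainProd w γ N N = c then h.choose else 1
  have hv : ∀ γ c, (∀ᶠ N : ℕ in Filter.atTop, chainProd w γ N N = c) → v γ = c := by
    intro γ c hc
    have h : ∃ c, ∀ᶠ N : ℕ in Filter.atTop, chainProd w γ N N = c := ⟨c, hc⟩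
    simp only [v, dif_pos h]
    obtain ⟨N, h1, h2⟩ := (h.choose_spec.and hc).exists
    exact h1.symm.trans h2
  refine ⟨v, ?_, ?_⟩
  · intro F s hs hF _ p hp q hq r hr
    -- The domain `s` need not be compact, but the triangle is.
    have hsub : convexHull ℝ {p, q, r} ⊆ s := convexHull_min (by
      rintro x (rfl | rfl | rfl) <;> assumption) hs
    have hmem : ∀ x ∈ ({p, q, r} : Set (ℝ × ℝ)), x ∈ convexHull ℝ {p, q, r} :=
      fun x hx => subset_convexHull ℝ _ hx
    obtain ⟨D, hD⟩ := exists_development hU hcov hw (convex_convexHull ℝ {p, q, r})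
      ((Set.toFinite _).isCompact_convexHull ℝ) (hF.mono hsub)
    rw [hv _ _ (hD p (hmem p (by simp)) q (hmem q (by simp))),
      hv _ _ (hD q (hmem q (by simp)) r (hmem r (by simp))),
      hv _ _ (hD p (hmem p (by simp)) r (hmem r (by simp)))]
    group
  · intro i γ hγ hi
    let F : ℝ × ℝ → X := fun x => γ (Set.projIcc 0 1 zero_le_one x.1)
    have hF : Continuous F := hγ.comp (continuous_projIcc.comp continuous_fst)
    have e : γ = F ∘ segmentMap ((0, 0) : ℝ × ℝ) (1, 0) := by
      funext t
      simp [F, segmentMap, AffineMap.lineMap_apply]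
    let D : ℝ × ℝ → G := fun x => w (F ∘ segmentMap ((0, 0) : ℝ × ℝ) x)
    have hD : ∀ x y, w (F ∘ segmentMap x y) = D y * (D x)⁻¹ := fun x y =>
      eq_mul_inv_of_mul_eq (hw i F Set.univ convex_univ hF.continuousOn (fun _ _ => hi _)
        (0, 0) trivial x trivial y trivial)
    apply hv
    filter_upwards [Filter.eventually_gt_atTop 0] with M hM
    have := chainProd_eq_of_forall w F (0, 0) (1, 0) hM D fun k _ => hD _ _
    rw [e, this, ← hD]

/-- The van Kampen theorem for flat transports: flat transports over the members of an open cover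
which agree on the overlaps glue. -/
theorem exists_flatOn_univ_of_agree {ι : Type*} {U : ι → Set X} (hU : ∀ i, IsOpen (U i))
    (hcov : ⋃ i, U i = Set.univ) {v : ι → (unitInterval → X) → G} (hv : ∀ i, FlatOn (U i) (v i))
    (hagree : ∀ i j γ, Continuous γ → (∀ t, γ t ∈ U i) → (∀ t, γ t ∈ U j) → v i γ = v j γ) :
    ∃ u : (unitInterval → X) → G, FlatOn Set.univ u ∧
      ∀ i γ, Continuous γ → (∀ t, γ t ∈ U i) → u γ = v i γ := by
  classical
  -- The value 1 on paths contained in no `U i` is harmless: flatness is only required inside each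
  -- `U i`.
  let w : (unitInterval → X) → G := fun γ =>
    if h : ∃ i, ∀ t, γ t ∈ U i then v h.choose γ else 1
  have hw : ∀ i γ, Continuous γ → (∀ t, γ t ∈ U i) → w γ = v i γ := by
    intro i γ hγ hi
    have h : ∃ i, ∀ t, γ t ∈ U i := ⟨i, hi⟩
    simp only [w, dif_pos h]
    exact hagree _ _ γ hγ h.choose_spec hi
  obtain ⟨u, hu, hu'⟩ := exists_flatOn_univ_of_cover hU hcov (w := w) fun i F s hs hF hm p hp q hq
      r hr => by
    have hc : ∀ a ∈ s, ∀ b ∈ s, w (F ∘ segmentMap a b) = v i (F ∘ segmentMap a b) :=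
      fun a ha b hb => hw i _ (continuous_comp_segmentMap hs hF ha hb)
        fun t => hm (segmentMap_mem hs ha hb t)
    rw [hc p hp q hq, hc q hq r hr, hc p hp r hr]
    exact hv i F s hs hF hm p hp q hq r hr
  exact ⟨u, hu, fun i γ hγ hi => (hu' i γ hγ hi).trans (hw i γ hγ hi)⟩

end Gluing

/-! ### Flat transports on the torus -/

/-- The universal covering of the torus. -/
def torusCover (p : ℝ × ℝ) : Torus := (Circle.exp p.1, Circle.exp p.2)

theorem continuous_torusCover : Continuous torusCover := by
  unfold torusCover; fun_prop

theorem exists_lift_torusCover {γ : unitInterval → Torus} (hγ : Continuous γ) :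
    ∃ δ : unitInterval → ℝ × ℝ, Continuous δ ∧ γ = torusCover ∘ δ := by
  have lift : ∀ g : unitInterval → Circle, Continuous g →
      ∃ d : unitInterval → ℝ, Continuous d ∧ ∀ t, g t = Circle.exp (d t) := by
    intro g hg
    obtain ⟨d, hd, _⟩ := Circle.isCoveringMap_exp.exists_path_lifts ⟨g, hg⟩
      ((g 0 : ℂ).arg) (Circle.exp_arg _).symm
    exact ⟨d, d.continuous, fun t => (congrFun hd t).symm⟩
  obtain ⟨d₁, h₁, e₁⟩ := lift _ (continuous_fst.comp hγ)
  obtain ⟨d₂, h₂, e₂⟩ := lift _ (continuous_snd.comp hγ)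
  exact ⟨fun t => (d₁ t, d₂ t), h₁.prodMk h₂, funext fun t => Prod.ext (e₁ t) (e₂ t)⟩

/-- In a convex space the transport along a path depends only on the end points. -/
theorem FlatOn.eq_segmentMap {G : Type*} [Group G] {v : (unitInterval → ℝ × ℝ) → G}
    (hv : FlatOn Set.univ v) {γ : unitInterval → ℝ × ℝ} (hγ : Continuous γ) :
    v γ = v (segmentMap (γ 0) (γ 1)) :=
  hv.homotopic (SimplyConnectedSpace.paths_homotopic
    (⟨⟨γ, hγ⟩, rfl, rfl⟩ : Path (γ 0) (γ 1))
    ⟨⟨segmentMap (γ 0) (γ 1), continuous_segmentMap _ _⟩, by simp, by simp⟩)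

/-- Two flat transports on the torus which agree on the two standard loops are equal up to a gauge
transformation. -/
theorem FlatOn.exists_gauge_torus {G : Type*} [Group G] {v v' : (unitInterval → Torus) → G}
    (hv : FlatOn Set.univ v) (hv' : FlatOn Set.univ v') (hX : v loopX = v' loopX)
    (hH : v loopH = v' loopH) :
    ∃ f : Torus → G, f (1, 1) = 1 ∧
      ∀ γ, Continuous γ → v' γ = f (γ 1) * v γ * (f (γ 0))⁻¹ := by
  have flat : ∀ {u : (unitInterval → Torus) → G}, FlatOn Set.univ u →
      FlatOn Set.univ (fun γ => u (torusCover ∘ γ)) := fun hu =>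
    hu.comp continuous_torusCover.continuousOn fun _ _ => trivial
  let d : ((unitInterval → Torus) → G) → ℝ × ℝ → G := fun u z => u (torusCover ∘ segmentMap 0 z)
  have hd : ∀ {u : (unitInterval → Torus) → G}, FlatOn Set.univ u → ∀ x y,
      u (torusCover ∘ segmentMap x y) * d u x = d u y := fun hu x y =>
    flat hu id Set.univ convex_univ continuousOn_id (fun _ _ => trivial) 0 trivial x trivial
      y trivial
  -- Translation by a period does not change the image of a segment in the torus, so a period
  -- multiplies the development on the right by its holonomy.
  have per : ∀ e : ℝ × ℝ, (∀ z, torusCover (z + e) = torusCover z) →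
      ∀ {u : (unitInterval → Torus) → G}, FlatOn Set.univ u → ∀ z,
        d u (z + e) = d u z * u (torusCover ∘ segmentMap 0 e) := by
    intro e he u hu z
    rw [← hd hu e (z + e)]
    congr 2
    funext t
    simp only [Function.comp_apply, segmentMap]
    refine (congrArg torusCover ?_).trans (he _)
    simp only [AffineMap.lineMap_apply, vsub_eq_sub, vadd_eq_add]
    module
  -- Equal holonomies cancel in this quotient of developments. It is therefore doubly periodic and
  -- descends to the gauge transformation.
  let g : ℝ × ℝ → G := fun z => d v' z * (d v z)⁻¹
  have hg : ∀ e : ℝ × ℝ, (∀ z, torusCover (z + e) = torusCover z) →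
      v (torusCover ∘ segmentMap 0 e) = v' (torusCover ∘ segmentMap 0 e) →
      ∀ z, g (z + e) = g z := by
    intro e he h z
    simp only [g]
    rw [per e he hv, per e he hv', h]
    group
  have eX : torusCover ∘ segmentMap 0 ((2 * Real.pi, 0) : ℝ × ℝ) = loopX := by
    funext t
    simp [torusCover, segmentMap, loopX, AffineMap.lineMap_apply, mul_comm]
  have eH : torusCover ∘ segmentMap 0 ((0, 2 * Real.pi) : ℝ × ℝ) = loopH := by
    funext t
    simp [torusCover, segmentMap, loopH, AffineMap.lineMap_apply, mul_comm]
  have g1 := hg (2 * Real.pi, 0) (fun z => by simp [torusCover]) (by rw [eX, hX])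
  have g2 := hg (0, 2 * Real.pi) (fun z => by simp [torusCover]) (by rw [eH, hH])
  have g1' : ∀ (x y : ℝ) (m : ℤ), g (x + m * (2 * Real.pi), y) = g (x, y) := by
    intro x y m
    have : Function.Periodic (fun x => g (x, y)) (2 * Real.pi) := fun x => by
      simpa using g1 (x, y)
    exact this.int_mul m x
  have g2' : ∀ (x y : ℝ) (m : ℤ), g (x, y + m * (2 * Real.pi)) = g (x, y) := by
    intro x y m
    have : Function.Periodic (fun y => g (x, y)) (2 * Real.pi) := fun y => by
      simpa using g2 (x, y)
    exact this.int_mul m y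
  refine ⟨fun p => g ((p.1 : ℂ).arg, (p.2 : ℂ).arg), ?_, ?_⟩
  · have e : ∀ u : (unitInterval → Torus) → G, FlatOn Set.univ u → d u 0 = 1 := by
      intro u hu
      simp only [d, segmentMap_self]
      exact (flat hu).const (Set.mem_univ 0)
    have h0 : (((1 : Circle) : ℂ).arg, ((1 : Circle) : ℂ).arg) = (0 : ℝ × ℝ) := by simp
    simp only [g]
    rw [h0, e v hv, e v' hv']
    simp
  · intro γ hγ
    obtain ⟨δ, hδ, rfl⟩ := exists_lift_torusCover hγ
    have hcov : ∀ z : ℝ × ℝ, g (((torusCover z).1 : ℂ).arg, ((torusCover z).2 : ℂ).arg) = g z := by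
      rintro ⟨x, y⟩
      obtain ⟨m, hm⟩ := Circle.exp_eq_exp.1 (Circle.exp_arg (Circle.exp x))
      obtain ⟨n, hn⟩ := Circle.exp_eq_exp.1 (Circle.exp_arg (Circle.exp y))
      simp only [torusCover]
      rw [hm, hn, g1', g2']
    have ev := (flat hv).eq_segmentMap hδ
    have ev' := (flat hv').eq_segmentMap hδ
    simp only [Function.comp_apply, hcov] at *
    rw [ev, ev', eq_mul_inv_of_mul_eq (hd hv _ _), eq_mul_inv_of_mul_eq (hd hv' _ _)]
    simp only [g]
    group

/-- The standard loops generate the fundamental group of the torus. -/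
theorem fundamentalGroup_torus_hom_ext {G : Type*} [Group G]
    {ρ ρ' : FundamentalGroup Torus (1, 1) →* G}
    (hX : ρ (FundamentalGroup.fromPath (Path.Homotopic.Quotient.mk loopX)) =
      ρ' (FundamentalGroup.fromPath (Path.Homotopic.Quotient.mk loopX)))
    (hH : ρ (FundamentalGroup.fromPath (Path.Homotopic.Quotient.mk loopH)) =
      ρ' (FundamentalGroup.fromPath (Path.Homotopic.Quotient.mk loopH))) : ρ = ρ' := by
  obtain ⟨f, f1, hf⟩ := (flatOn_transportOf ρ).exists_gauge_torus (flatOn_transportOf ρ')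
    (by rwa [transportOf_path, transportOf_path]) (by rwa [transportOf_path, transportOf_path])
  refine MonoidHom.ext ?_
  rintro ⟨γ⟩
  have := hf γ γ.continuous
  rw [transportOf_path, transportOf_path, γ.source, γ.target, f1] at this
  rw [one_mul, inv_one, mul_one] at this
  exact this.symm

/-! ### Flat transports on `C₂` -/

namespace C2

/-- The involution `(u, t, w) ↦ (-u, -t, w⁻¹)`. -/
def flip (p : C2Cover) : C2Cover :=
  ⟨(-p.1.1, -p.1.2.1, p.1.2.2⁻¹), by
    refine ⟨by simpa using p.2.1, fun s hs => ?_⟩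
    have := p.2.2 s (by
      rcases hs with hs | hs
      · exact Or.inr (neg_eq_iff_eq_neg.1 hs)
      · exact Or.inl (neg_inj.1 hs))
    simpa using this⟩

/-- The quotient map onto `C₂`. -/
def proj (p : C2Cover) : C2 := Quotient.mk C2Setoid p

theorem flip_flip (p : C2Cover) : flip (flip p) = p := by
  apply Subtype.ext
  simp [flip]

theorem continuous_neg_circle : Continuous (fun u : Circle => -u) :=
  Continuous.subtype_mk (continuous_subtype_val.neg) _

theorem continuous_flip : Continuous flip := by
  refine Continuous.subtype_mk ?_ _
  exact (continuous_neg_circle.comp (continuous_fst.comp continuous_subtype_val)).prodMk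
    (by fun_prop)

theorem continuous_proj : Continuous proj := continuous_quotient_mk'

theorem proj_eq_proj_iff {p q : C2Cover} : proj p = proj q ↔ q = p ∨ q = flip p := by
  refine (Quotient.eq (r := C2Setoid)).trans (or_congr Iff.rfl ?_)
  rw [Subtype.ext_iff, Prod.ext_iff, Prod.ext_iff]
  rfl

theorem proj_flip (p : C2Cover) : proj (flip p) = proj p :=
  (proj_eq_proj_iff.2 (Or.inr rfl)).symm

theorem proj_surjective : Function.Surjective proj := Quotient.mk_surjective

theorem isQuotientMap_proj : Topology.IsQuotientMap proj := isQuotientMap_quotient_mk'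

theorem isOpenMap_proj : IsOpenMap proj := by
  intro U hU
  rw [← isQuotientMap_proj.isOpen_preimage]
  have : proj ⁻¹' (proj '' U) = U ∪ flip ⁻¹' U := by
    ext p
    constructor
    · rintro ⟨q, hq, h⟩
      rcases proj_eq_proj_iff.1 h with rfl | rfl
      · exact Or.inl hq
      · exact Or.inr (by simpa [flip_flip] using hq)
    · rintro (h | h)
      · exact ⟨p, h, rfl⟩
      · exact ⟨_, h, proj_flip p⟩
  rw [this]
  exact hU.union (hU.preimage continuous_flip)

/-- The upper half of the cover: a fundamental domain of the involution. -/
def Upper (p : C2Cover) : Prop := 0 < (p.1.1 : ℂ).im ∨ p.1.1 = 1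

theorem eq_one_or_neg_one_of_im {u : Circle} (h : (u : ℂ).im = 0) : u = 1 ∨ u = -1 := by
  have h1 := Circle.normSq_coe u
  rw [Complex.normSq_apply, h, mul_zero, add_zero] at h1
  rcases mul_self_eq_one_iff.1 h1 with h2 | h2
  · exact Or.inl (Circle.ext (Complex.ext (by simpa using h2) (by simpa using h)))
  · exact Or.inr (Circle.ext (Complex.ext (by simpa using h2) (by simpa using h)))

theorem one_ne_neg_one_circle : (1 : Circle) ≠ -1 := fun h => by
  have := congrArg (fun u : Circle => (u : ℂ).re) h
  norm_num at this

/-- The involution exchanges the two open halves of the circle and exchanges u = 1 with u = -1; of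
the last two only u = 1 is kept. -/
theorem upper_flip_iff (p : C2Cover) : Upper (flip p) ↔ ¬ Upper p := by
  have e : Upper (flip p) ↔ (p.1.1 : ℂ).im < 0 ∨ p.1.1 = -1 := by
    simp only [Upper, flip]
    refine or_congr (by simp) neg_eq_iff_eq_neg
  rw [e]
  constructor
  · rintro (h | h) (h' | h')
    · linarith
    · simp [h'] at h
    · simp [h] at h'
    · exact one_ne_neg_one_circle (h'.symm.trans h)
  · intro h
    rcases lt_trichotomy (p.1.1 : ℂ).im 0 with h0 | h0 | h0
    · exact Or.inl h0
    · exact (eq_one_or_neg_one_of_im h0).elim (fun h1 => (h (Or.inr h1)).elim) Or.inr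
    · exact (h (Or.inl h0)).elim

theorem exists_upper (q : C2) : ∃ p, proj p = q ∧ Upper p := by
  obtain ⟨p, rfl⟩ := proj_surjective q
  by_cases h : Upper p
  · exact ⟨p, rfl, h⟩
  · exact ⟨flip p, proj_flip p, (upper_flip_iff p).2 h⟩

/-- The representative of a point of `C₂` in the fundamental domain. -/
def rep (q : C2) : C2Cover := (exists_upper q).choose

theorem proj_rep (q : C2) : proj (rep q) = q := (exists_upper q).choose_spec.1

theorem upper_rep (q : C2) : Upper (rep q) := (exists_upper q).choose_spec.2

theorem rep_proj_of_upper {p : C2Cover} (h : Upper p) : rep (proj p) = p := by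
  rcases proj_eq_proj_iff.1 (proj_rep (proj p)) with h' | h'
  · exact h'.symm
  · have := upper_rep (proj p)
    rw [h', upper_flip_iff] at h
    exact (h this).elim

theorem rep_proj_of_not_upper {p : C2Cover} (h : ¬ Upper p) : rep (proj p) = flip p := by
  rw [← proj_flip, rep_proj_of_upper ((upper_flip_iff p).2 h)]

/-- The three open pieces of the base of the cover. -/
def baseChart : Option Bool → Set C2Cover
  | none => {p | 0 < (p.1.1 : ℂ).im}
  | some true => {p | 0 < p.1.2.1 ∧ 0 < (p.1.1 : ℂ).re}
  | some false => {p | 0 < p.1.2.1 ∧ (p.1.1 : ℂ).re < 0}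

/-- The point of the circle that is removed in the two charts of the fibre. -/
def fibrePole : Bool → Circle
  | true => -1
  | false => 1

/-- The charts of `C₂`. -/
def chart (x : Option Bool × Bool) : Set C2 :=
  proj '' (baseChart x.1 ∩ {p | p.1.2.2 ≠ fibrePole x.2})

theorem isOpen_chart (x : Option Bool × Bool) : IsOpen (chart x) := by
  refine isOpenMap_proj _ (IsOpen.inter ?_ ?_)
  · have h1 : Continuous fun p : C2Cover => (p.1.1 : ℂ).im := by fun_prop
    have h2 : Continuous fun p : C2Cover => (p.1.1 : ℂ).re := by fun_prop
    have h3 : Continuous fun p : C2Cover => p.1.2.1 := by fun_prop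
    rcases x with ⟨_ | _ | _, _⟩
    · exact isOpen_lt continuous_const h1
    · exact (isOpen_lt continuous_const h3).inter (isOpen_lt h2 continuous_const)
    · exact (isOpen_lt continuous_const h3).inter (isOpen_lt continuous_const h2)
  · exact isOpen_ne_fun (by fun_prop) continuous_const

theorem mem_chart_iff {p : C2Cover} {x : Option Bool × Bool} : proj p ∈ chart x ↔
    (p ∈ baseChart x.1 ∨ flip p ∈ baseChart x.1) ∧ p.1.2.2 ≠ fibrePole x.2 := by
  have hf : (flip p).1.2.2 ≠ fibrePole x.2 ↔ p.1.2.2 ≠ fibrePole x.2 := by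
    have : (fibrePole x.2)⁻¹ = fibrePole x.2 := by
      rcases x with ⟨_, _ | _⟩ <;> simp [fibrePole]
    simp only [flip]
    rw [← this, Ne, inv_inj, this]
  constructor
  · rintro ⟨q, ⟨h1, h2⟩, h⟩
    rcases proj_eq_proj_iff.1 h.symm with rfl | rfl
    · exact ⟨Or.inl h1, h2⟩
    · exact ⟨Or.inr h1, hf.1 h2⟩
  · rintro ⟨h1 | h1, h2⟩
    · exact ⟨p, ⟨h1, h2⟩, rfl⟩
    · exact ⟨flip p, ⟨h1, hf.2 h2⟩, proj_flip p⟩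

/-- The removed discs are centred at (±1, 0), so each segment u = ±1 falls into two walls, t > 0 and
t < 0. Up to the involution there are two walls, which is why `δ` is indexed by `Bool`. -/
theorem height_ne_zero_of_im_eq_zero {p : C2Cover} (h : (p.1.1 : ℂ).im = 0) : p.1.2.1 ≠ 0 := by
  intro h0
  have := p.2.2 0 (by
    rw [Circle.exp_zero]
    exact eq_one_or_neg_one_of_im h)
  rw [h0] at this
  norm_num at this

theorem exists_mem_baseChart (p : C2Cover) :
    ∃ i, p ∈ baseChart i ∨ flip p ∈ baseChart i := by
  rcases lt_trichotomy (p.1.1 : ℂ).im 0 with h | h | h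
  · exact ⟨none, Or.inr (by simpa [baseChart, flip] using h)⟩
  · have ht := height_ne_zero_of_im_eq_zero h
    rcases eq_one_or_neg_one_of_im h with hu | hu <;> rcases ht.lt_or_gt with ht | ht
    · exact ⟨some false, Or.inr (by simpa [baseChart, flip, hu] using ht)⟩
    · exact ⟨some true, Or.inl (by simpa [baseChart, flip, hu] using ht)⟩
    · exact ⟨some true, Or.inr (by simpa [baseChart, flip, hu] using ht)⟩
    · exact ⟨some false, Or.inl (by simpa [baseChart, flip, hu] using ht)⟩
  · exact ⟨none, Or.inl h⟩

theorem iUnion_chart : ⋃ x, chart x = Set.univ := by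
  refine Set.eq_univ_of_forall fun q => ?_
  obtain ⟨p, rfl⟩ := proj_surjective q
  obtain ⟨i, hi⟩ := exists_mem_baseChart p
  by_cases hw : p.1.2.2 = 1
  · exact Set.mem_iUnion.2 ⟨(i, true), mem_chart_iff.2 ⟨hi, hw ▸ one_ne_neg_one_circle⟩⟩
  · exact Set.mem_iUnion.2 ⟨(i, false), mem_chart_iff.2 ⟨hi, hw⟩⟩

/-! ### Trivializations over the charts of C₂ and their transition functions -/

section Transport

variable {G : Type*} [Group G] (δ : Bool → G) (H : G)

/-- The trivialization along the fibre. -/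
def fibreTriv (ε : Bool) (w : Circle) : G :=
  -- The two fibre charts overlap in two arcs. The transition function is 1 on one arc and `H` on
  -- the other, which produces the holonomy of the fibre.
  if ε = false ∧ (w : ℂ).im < 0 then H else 1

/-- The trivialization along the base. -/
def baseTriv (x : Option Bool × Bool) (t : ℝ) : G :=
  match x with
  | (none, _) => 1
  -- A wall chart has representatives with t > 0 on one side of the wall and with t < 0 on the
  -- other. The extra `H` for ε = false compensates for w ↦ w⁻¹, which swaps the two arcs.
  | (some b, ε) => if 0 < t then 1 else δ b * if ε then 1 else H

/-- The trivialization over a chart. -/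
def triv (x : Option Bool × Bool) (q : C2) : G :=
  fibreTriv H x.2 (rep q).1.2.2 * baseTriv δ H x (rep q).1.2.1

theorem triv_of_upper (x : Option Bool × Bool) {p : C2Cover} (h : Upper p) :
    triv δ H x (proj p) = fibreTriv H x.2 p.1.2.2 * baseTriv δ H x p.1.2.1 := by
  rw [triv, rep_proj_of_upper h]

theorem triv_of_not_upper (x : Option Bool × Bool) {p : C2Cover} (h : ¬ Upper p) :
    triv δ H x (proj p) = fibreTriv H x.2 p.1.2.2⁻¹ * baseTriv δ H x (-p.1.2.1) := by
  rw [triv, rep_proj_of_not_upper h]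
  rfl

variable {δ H}

theorem im_ne_zero_of_ne {w : Circle} (h1 : w ≠ 1) (h2 : w ≠ -1) : (w : ℂ).im ≠ 0 := fun h =>
  (eq_one_or_neg_one_of_im h).elim h1 h2

theorem eventually_fibreTriv (ε ε' : Bool) {w : Circle} (h : w ≠ fibrePole ε)
    (h' : w ≠ fibrePole ε') : ∀ᶠ z in nhds w,
      (fibreTriv H ε z)⁻¹ * fibreTriv H ε' z = (fibreTriv H ε w)⁻¹ * fibreTriv H ε' w := by
  by_cases e : ε = ε'
  · subst e
    simp
  have hw : (w : ℂ).im ≠ 0 := by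
    cases ε <;> cases ε' <;> first | exact (e rfl).elim | skip
    · exact im_ne_zero_of_ne h h'
    · exact im_ne_zero_of_ne h' h
  have hc : Continuous fun z : Circle => (z : ℂ).im := by fun_prop
  rcases hw.lt_or_gt with hw | hw
  · filter_upwards [hc.continuousAt.eventually_lt continuousAt_const hw] with z hz
    simp [fibreTriv, hz, hw]
  · filter_upwards [continuousAt_const.eventually_lt hc.continuousAt hw] with z hz
    simp [fibreTriv, hz.not_gt, hw.not_gt]

/-- Crossing a wall inverts the fibre coordinate and so swaps the two arcs of the overlap. The
transition functions still match because `δ b` conjugates `H` to its inverse; this is where the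
relation z h z⁻¹ h = 1 enters. -/
theorem fibreTriv_inv (hδ : ∀ b, δ b * H * (δ b)⁻¹ = H⁻¹) (b ε ε' : Bool) {w : Circle}
    (h : w ≠ fibrePole ε) (h' : w ≠ fibrePole ε') :
    (δ b * if ε then 1 else H)⁻¹ * ((fibreTriv H ε w)⁻¹ * fibreTriv H ε' w) *
      (δ b * if ε' then 1 else H) = (fibreTriv H ε w⁻¹)⁻¹ * fibreTriv H ε' w⁻¹ := by
  by_cases e : ε = ε'
  · subst e
    simp only [inv_mul_cancel, mul_one]
  have hw : (w : ℂ).im ≠ 0 := by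
    cases ε <;> cases ε' <;> first | exact (e rfl).elim | skip
    · exact im_ne_zero_of_ne h h'
    · exact im_ne_zero_of_ne h' h
  have hinv : ((w⁻¹ : Circle) : ℂ).im = -(w : ℂ).im := by
    rw [Circle.coe_inv_eq_conj, Complex.conj_im]
  have hA : (δ b)⁻¹ * H * δ b = H⁻¹ := by
    have := congrArg (fun g => (δ b)⁻¹ * g⁻¹ * δ b) (hδ b)
    rw [inv_inv] at this
    rw [← this]
    group
  have hd : (δ b)⁻¹ * (H * (δ b * H)) = 1 := by
    rw [← mul_assoc, ← mul_assoc, hA, inv_mul_cancel]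
  have hd' : (δ b * H)⁻¹ * (H⁻¹ * δ b) = 1 := by
    rw [show (δ b * H)⁻¹ * (H⁻¹ * δ b) = H⁻¹ * ((δ b)⁻¹ * H * δ b)⁻¹ by group, hA]
    group
  rcases hw.lt_or_gt with hw | hw <;> cases ε <;> cases ε' <;>
    first | exact (e rfl).elim | skip
  · simpa [fibreTriv, hinv, hw, hw.not_gt, mul_assoc] using hd'
  · simpa [fibreTriv, hinv, hw, hw.not_gt, mul_assoc] using hd
  · simp [fibreTriv, hw, hw.not_gt]
  · simp [fibreTriv, hw, hw.not_gt]

theorem baseTriv_some_of_pos (b ε : Bool) {t : ℝ} (ht : 0 < t) :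
    baseTriv δ H (some b, ε) t = 1 := if_pos ht

theorem baseTriv_some_of_neg (b ε : Bool) {t : ℝ} (ht : t < 0) :
    baseTriv δ H (some b, ε) t = δ b * if ε then 1 else H := if_neg ht.not_gt

/-- `baseTriv` sees only the sign of t, and t ≠ 0 on the wall charts. -/
theorem eventually_baseTriv {x : Option Bool × Bool} {p : C2Cover}
    (hx : p ∈ baseChart x.1 ∨ flip p ∈ baseChart x.1) :
    ∀ᶠ q : C2Cover in nhds p, baseTriv δ H x q.1.2.1 = baseTriv δ H x p.1.2.1 := by
  rcases x with ⟨_ | b, ε⟩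
  · exact Filter.Eventually.of_forall fun _ => rfl
  have hc : Continuous fun p : C2Cover => p.1.2.1 := by fun_prop
  have ht : p.1.2.1 ≠ 0 := by
    rcases hx with hx | hx <;> cases b <;> have := hx.1
    · exact this.ne'
    · exact this.ne'
    · exact fun h => by simp [flip, h] at this
    · exact fun h => by simp [flip, h] at this
  rcases ht.lt_or_gt with ht | ht
  · filter_upwards [hc.continuousAt.eventually_lt continuousAt_const ht] with q hq
    rw [baseTriv_some_of_neg b ε ht, baseTriv_some_of_neg b ε hq]
  · filter_upwards [continuousAt_const.eventually_lt hc.continuousAt ht] with q hq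
    rw [baseTriv_some_of_pos b ε ht, baseTriv_some_of_pos b ε hq]

/-- The only chart of the base that contains a given wall point. -/
theorem eq_of_mem_baseChart_wall {p : C2Cover} (hp : p.1.1 = 1) {i : Option Bool}
    (hi : p ∈ baseChart i ∨ flip p ∈ baseChart i) :
    (0 < p.1.2.1 ∧ i = some true) ∨ (p.1.2.1 < 0 ∧ i = some false) := by
  rcases i with _ | _ | _
  · rcases hi with hi | hi <;> simp [baseChart, flip, hp] at hi
  · rcases hi with hi | hi
    · have := hi.2
      norm_num [hp] at this
    · exact Or.inr ⟨by simpa [flip] using hi.1, rfl⟩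
  · rcases hi with hi | hi
    · exact Or.inl ⟨hi.1, rfl⟩
    · have := hi.2
      norm_num [hp, flip] at this

/-- Off the wall u = 1 the representative varies continuously. At a wall point both charts belong to
the same wall, while nearby points may have flipped representatives; `fibreTriv_inv` compares the
two sides. -/
theorem eventually_triv (hδ : ∀ b, δ b * H * (δ b)⁻¹ = H⁻¹) {x y : Option Bool × Bool} {q : C2}
    (hx : q ∈ chart x) (hy : q ∈ chart y) : ∀ᶠ q' in nhds q,
      (triv δ H x q')⁻¹ * triv δ H y q' = (triv δ H x q)⁻¹ * triv δ H y q := by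
  obtain ⟨p, rfl, hp⟩ := exists_upper q
  refine isOpenMap_proj.nhds_le p ?_
  change ∀ᶠ p' in nhds p, _
  obtain ⟨hx1, hx2⟩ := mem_chart_iff.1 hx
  obtain ⟨hy1, hy2⟩ := mem_chart_iff.1 hy
  have hcw : Continuous fun p : C2Cover => p.1.2.2 := by fun_prop
  have hct : Continuous fun p : C2Cover => p.1.2.1 := by fun_prop
  have hcu : Continuous fun p : C2Cover => (p.1.1 : ℂ).im := by fun_prop
  have hK := hcw.continuousAt.eventually (eventually_fibreTriv (H := H) x.2 y.2 hx2 hy2)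
  rcases hp with hp | hp
  · filter_upwards [hK, eventually_baseTriv (δ := δ) (H := H) hx1,
      eventually_baseTriv (δ := δ) (H := H) hy1,
      continuousAt_const.eventually_lt hcu.continuousAt hp] with p' h1 h2 h3 h4
    rw [triv_of_upper δ H x (Or.inl h4), triv_of_upper δ H y (Or.inl h4),
      triv_of_upper δ H x (Or.inl hp), triv_of_upper δ H y (Or.inl hp), h2, h3]
    simp only [mul_inv_rev, mul_assoc]
    rw [← mul_assoc (fibreTriv H x.2 _)⁻¹, h1]
    simp only [mul_assoc]
  · obtain ⟨i, ε⟩ := x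
    obtain ⟨j, ε'⟩ := y
    have hKx := hcw.continuousAt.eventually (isOpen_ne.eventually_mem hx2)
    have hKy := hcw.continuousAt.eventually (isOpen_ne.eventually_mem hy2)
    have hflip : ∀ {z w : Circle}, z ≠ fibrePole ε → z ≠ fibrePole ε' →
        w ≠ fibrePole ε → w ≠ fibrePole ε' →
        (fibreTriv H ε z)⁻¹ * fibreTriv H ε' z = (fibreTriv H ε w)⁻¹ * fibreTriv H ε' w →
        (fibreTriv H ε z⁻¹)⁻¹ * fibreTriv H ε' z⁻¹ =
          (fibreTriv H ε w⁻¹)⁻¹ * fibreTriv H ε' w⁻¹ := by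
      intro z w h1 h2 h3 h4 h
      rw [← fibreTriv_inv hδ true ε ε' h1 h2, ← fibreTriv_inv hδ true ε ε' h3 h4, h]
    have pole_inv : ∀ (ε : Bool) {w : Circle}, w ≠ fibrePole ε → w⁻¹ ≠ fibrePole ε := by
      rintro ε w hw h
      apply hw
      rw [← inv_inv w, h]
      cases ε <;> simp [fibrePole]
    rcases eq_of_mem_baseChart_wall hp hx1 with ⟨ht, rfl⟩ | ⟨ht, rfl⟩ <;>
      rcases eq_of_mem_baseChart_wall hp hy1 with ⟨ht', rfl⟩ | ⟨ht', rfl⟩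
    · filter_upwards [hK, hKx, hKy, continuousAt_const.eventually_lt hct.continuousAt ht]
        with p' h1 h2 h3 h4
      rw [triv_of_upper δ H _ (Or.inr hp), triv_of_upper δ H _ (Or.inr hp),
        baseTriv_some_of_pos _ _ ht, baseTriv_some_of_pos _ _ ht, mul_one, mul_one, ← h1]
      by_cases hu : Upper p'
      · rw [triv_of_upper δ H _ hu, triv_of_upper δ H _ hu,
          baseTriv_some_of_pos _ _ h4, baseTriv_some_of_pos _ _ h4, mul_one, mul_one]
      · have h5 : -p'.1.2.1 < 0 := by linarith
        rw [triv_of_not_upper δ H _ hu, triv_of_not_upper δ H _ hu,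
          baseTriv_some_of_neg _ _ h5, baseTriv_some_of_neg _ _ h5]
        have := fibreTriv_inv hδ true ε ε' (pole_inv ε h2) (pole_inv ε' h3)
        rw [inv_inv] at this
        rw [← this]
        group
    · linarith
    · linarith
    · filter_upwards [hK, hKx, hKy, hct.continuousAt.eventually_lt continuousAt_const ht]
        with p' h1 h2 h3 h4
      have hR : (triv δ H (some false, ε) (proj p))⁻¹ * triv δ H (some false, ε') (proj p) =
          (fibreTriv H ε (p.1.2.2)⁻¹)⁻¹ * fibreTriv H ε' (p.1.2.2)⁻¹ := by
        rw [triv_of_upper δ H _ (Or.inr hp), triv_of_upper δ H _ (Or.inr hp),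
          baseTriv_some_of_neg _ _ ht, baseTriv_some_of_neg _ _ ht,
          ← fibreTriv_inv hδ false ε ε' hx2 hy2]
        group
      rw [hR, ← hflip h2 h3 hx2 hy2 h1]
      by_cases hu : Upper p'
      · rw [triv_of_upper δ H _ hu, triv_of_upper δ H _ hu,
          baseTriv_some_of_neg _ _ h4, baseTriv_some_of_neg _ _ h4,
          ← fibreTriv_inv hδ false ε ε' h2 h3]
        group
      · have h5 : 0 < -p'.1.2.1 := by linarith
        rw [triv_of_not_upper δ H _ hu, triv_of_not_upper δ H _ hu,
          baseTriv_some_of_pos _ _ h5, baseTriv_some_of_pos _ _ h5, mul_one, mul_one]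

/-- The flat transport on `C₂` whose value on a path in a chart is read off from the
trivialization over the chart. -/
theorem exists_flatOn_triv (hδ : ∀ b, δ b * H * (δ b)⁻¹ = H⁻¹) :
    ∃ v : (unitInterval → C2) → G, FlatOn Set.univ v ∧ ∀ x γ, Continuous γ →
      (∀ t, γ t ∈ chart x) → v γ = triv δ H x (γ 1) * (triv δ H x (γ 0))⁻¹ := by
  refine exists_flatOn_univ_of_agree isOpen_chart iUnion_chart
    (fun x => FlatOn.of_fun (triv δ H x)) fun x y γ hγ hx hy => ?_
  -- A locally constant transition function is constant along the path, so both charts read off the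
  -- same value.
  have hloc : IsLocallyConstant fun t => (triv δ H x (γ t))⁻¹ * triv δ H y (γ t) :=
    (IsLocallyConstant.iff_eventually_eq _).2 fun t =>
      hγ.continuousAt.eventually (eventually_triv hδ (hx t) (hy t))
  have h01 := hloc.apply_eq_of_isPreconnected isPreconnected_univ (Set.mem_univ 0)
    (Set.mem_univ 1)
  have h1 : triv δ H y (γ 1) = triv δ H x (γ 1) * ((triv δ H x (γ 0))⁻¹ * triv δ H y (γ 0)) := by
    rw [h01, mul_inv_cancel_left]
  rw [h1]
  group

end Transport

end C2

namespace C2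

/-- The point of the fibre over the base point of `p` with fibre coordinate `w`. -/
def inFibre (p : C2Cover) (w : Circle) : C2Cover := ⟨(p.1.1, p.1.2.1, w), p.2⟩

theorem continuous_inFibre (p : C2Cover) : Continuous (inFibre p) :=
  Continuous.subtype_mk (by fun_prop) _

/-! ### Holonomies along fibres, boundary loops and connecting paths -/

section Holonomy

variable {G : Type*} [Group G] {δ : Bool → G} {H : G} {v : (unitInterval → C2) → G}

theorem transport_interval (hv : ∀ x γ, Continuous γ → (∀ t, γ t ∈ chart x) →
    v γ = triv δ H x (γ 1) * (triv δ H x (γ 0))⁻¹) (x : Option Bool × Bool) {γ : ℝ → C2}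
    (hγ : Continuous γ) {a b : ℝ} (hab : a ≤ b) (h : ∀ θ ∈ Set.Icc a b, γ θ ∈ chart x) :
    v (γ ∘ segmentMap a b) = triv δ H x (γ b) * (triv δ H x (γ a))⁻¹ := by
  rw [hv x _ (hγ.comp (continuous_segmentMap a b)) fun t => h _ (segmentMap_mem (convex_Icc a b)
    (Set.left_mem_Icc.2 hab) (Set.right_mem_Icc.2 hab) t)]
  simp

theorem mem_of_mem_zero {u w : Circle} (h : (u, 0, w) ∈ C2Cover) {t : ℝ} (ht : |t| ≤ 1) :
    (u, t, w) ∈ C2Cover :=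
  ⟨ht, fun s hs => by
    have := h.2 s hs
    have h2 := sq_nonneg t
    simp only at this ⊢
    nlinarith⟩

theorem sigma2_base_mem : (-Circle.exp (1 / 2), 0, 1) ∈ C2Cover := by
  simpa using sigma2_mem (1, 1)

/-- The vertical path from the base point of `Σ₂'` to `Σ₁'`. -/
def vert (r : unitInterval) : C2 :=
  proj ⟨(-Circle.exp (1 / 2), r, 1), mem_of_mem_zero sigma2_base_mem
    (by rw [abs_of_nonneg r.2.1]; exact r.2.2)⟩

theorem continuous_vert : Continuous vert :=
  continuous_proj.comp (Continuous.subtype_mk (by fun_prop) _)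

theorem vert_zero : vert 0 = sigma2 (1, 1) := by
  refine congrArg proj (Subtype.ext ?_)
  simp

/-- The arc in `Σ₁'` from the end point of the vertical path to the base point. -/
def arc (t : unitInterval) : Torus :=
  (Circle.exp (segmentMap (Real.pi + 1 / 2) (2 * Real.pi) t), 1)

theorem continuous_arc : Continuous arc :=
  (Circle.exp.continuous.comp (continuous_segmentMap _ _)).prodMk continuous_const

theorem vert_one : vert 1 = sigma1 (arc 0) := by
  have : Circle.exp (Real.pi + 1 / 2) = -Circle.exp (1 / 2) := by
    apply Circle.ext
    rw [Circle.coe_exp, Complex.ofReal_add, add_mul, Complex.exp_add, Complex.exp_pi_mul_I,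
      neg_one_mul]
    simp
  simp only [vert, sigma1, proj, arc, segmentMap_zero, this]
  rfl

theorem arc_one : arc 1 = (1, 1) := by
  rw [arc, segmentMap_one, Circle.exp_two_pi]

theorem circle_exp_re (θ : ℝ) : (Circle.exp θ : ℂ).re = Real.cos θ := by
  rw [Circle.coe_exp, Complex.exp_ofReal_mul_I_re]

theorem circle_exp_im (θ : ℝ) : (Circle.exp θ : ℂ).im = Real.sin θ := by
  rw [Circle.coe_exp, Complex.exp_ofReal_mul_I_im]

theorem circle_exp_ne_neg_one {θ : ℝ} (h : 0 ≤ Real.cos θ) : Circle.exp θ ≠ -1 := fun h' => by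
  have := congrArg (fun z : Circle => (z : ℂ).re) h'
  simp only [circle_exp_re] at this
  norm_num [this] at h

theorem circle_exp_ne_one {θ : ℝ} (h : Real.cos θ ≤ 0) : Circle.exp θ ≠ 1 := fun h' => by
  have := congrArg (fun z : Circle => (z : ℂ).re) h'
  simp only [circle_exp_re] at this
  norm_num [this] at h

theorem mem_baseChart_inFibre {p : C2Cover} {i : Option Bool}
    (hi : p ∈ baseChart i ∨ flip p ∈ baseChart i) (w : Circle) :
    inFibre p w ∈ baseChart i ∨ flip (inFibre p w) ∈ baseChart i := by
  rcases i with _ | _ | _ <;> exact hi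

-- The fibre is cut at π/2 and 3π/2, where the two fibre charts overlap. The jump `H` sits at 3π/2
-- if the representative is not flipped, and at π/2, with inverse effect, if it is.
open Real in
theorem transport_fibre (hf : FlatOn Set.univ v)
    (hv : ∀ x γ, Continuous γ → (∀ t, γ t ∈ chart x) →
      v γ = triv δ H x (γ 1) * (triv δ H x (γ 0))⁻¹) (p : C2Cover) [Decidable (Upper p)] :
    v (fun t => proj (inFibre p (Circle.exp (2 * π * t)))) = if Upper p then H else H⁻¹ := by
  obtain ⟨i, hi⟩ := exists_mem_baseChart p
  have hpi := Real.pi_pos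
  let γ : ℝ → C2 := fun θ => proj (inFibre p (Circle.exp θ))
  have hγ : Continuous γ := continuous_proj.comp ((continuous_inFibre p).comp
    Circle.exp.continuous)
  have e : (fun t : unitInterval => proj (inFibre p (Circle.exp (2 * π * t)))) =
      γ ∘ segmentMap 0 (2 * π) := by
    funext t
    simp only [γ, Function.comp_apply, segmentMap_zero_left]
  have plus : ∀ θ, 0 ≤ cos θ → γ θ ∈ chart (i, true) := fun θ h =>
    mem_chart_iff.2 ⟨mem_baseChart_inFibre hi _, circle_exp_ne_neg_one h⟩
  have minus : ∀ θ, cos θ ≤ 0 → γ θ ∈ chart (i, false) := fun θ h =>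
    mem_chart_iff.2 ⟨mem_baseChart_inFibre hi _, circle_exp_ne_one h⟩
  have s1 : v (γ ∘ segmentMap 0 (π / 2)) = _ := transport_interval hv (i, true) hγ (by linarith)
    fun θ h => plus θ (cos_nonneg_of_mem_Icc ⟨by linarith [h.1], h.2⟩)
  have s2 : v (γ ∘ segmentMap (π / 2) (π + π / 2)) = _ :=
    transport_interval hv (i, false) hγ (by linarith)
    fun θ h => minus θ (cos_nonpos_of_pi_div_two_le_of_le h.1 h.2)
  have s3 : v (γ ∘ segmentMap (π + π / 2) (2 * π)) = _ :=
    transport_interval hv (i, true) hγ (by linarith)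
    fun θ h => plus θ (by
      rw [← cos_sub_two_pi]
      exact cos_nonneg_of_mem_Icc ⟨by linarith [h.1], by linarith [h.2]⟩)
  have m : ∀ a b c : ℝ, v (γ ∘ segmentMap b c) * v (γ ∘ segmentMap a b) = v (γ ∘ segmentMap a c) :=
    fun a b c => hf.interval convex_univ hγ.continuousOn (fun _ _ => trivial) trivial trivial
      trivial
  rw [e, ← m 0 (π + π / 2) (2 * π), ← m 0 (π / 2) (π + π / 2), s1, s2, s3]
  have i1 : (Circle.exp (π / 2) : ℂ).im = 1 := by rw [circle_exp_im, sin_pi_div_two]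
  have i2 : (Circle.exp (π + π / 2) : ℂ).im = -1 := by
    rw [circle_exp_im, add_comm, sin_add_pi, sin_pi_div_two]
  have inv_im : ∀ w : Circle, ((w⁻¹ : Circle) : ℂ).im = -(w : ℂ).im := fun w => by
    rw [Circle.coe_inv_eq_conj, Complex.conj_im]
  split_ifs with hu
  · have ht : ∀ ε θ, triv δ H (i, ε) (γ θ) =
        fibreTriv H ε (Circle.exp θ) * baseTriv δ H (i, ε) p.1.2.1 := fun ε θ =>
      triv_of_upper δ H (i, ε) (p := inFibre p (Circle.exp θ)) hu
    simp only [ht, fibreTriv, i1, i2]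
    norm_num
  · have ht : ∀ ε θ, triv δ H (i, ε) (γ θ) =
        fibreTriv H ε (Circle.exp θ)⁻¹ * baseTriv δ H (i, ε) (-p.1.2.1) := fun ε θ =>
      triv_of_not_upper δ H (i, ε) (p := inFibre p (Circle.exp θ)) hu
    simp only [ht, fibreTriv, inv_im, i1, i2]
    norm_num

/-- The value of a trivialization at a point whose fibre coordinate is `1`. -/
theorem triv_true_of_upper (i : Option Bool) {p : C2Cover} (h : Upper p) :
    triv δ H (i, true) (proj p) = baseTriv δ H (i, true) p.1.2.1 := by
  rw [triv_of_upper δ H _ h]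
  simp [fibreTriv]

theorem triv_true_of_not_upper (i : Option Bool) {p : C2Cover} (h : ¬ Upper p) :
    triv δ H (i, true) (proj p) = baseTriv δ H (i, true) (-p.1.2.1) := by
  rw [triv_of_not_upper δ H _ h]
  simp [fibreTriv]

theorem not_upper_of_im_neg {p : C2Cover} (h : (p.1.1 : ℂ).im < 0) : ¬ Upper p := by
  rintro (h' | h')
  · linarith
  · simp [h'] at h

-- Two walls are crossed: `false` at θ = π, to the side where the representative has t < 0, and
-- `true` at θ = 2π, in the opposite direction. Nothing else contributes.
open Real in
theorem transport_sigma1_loopX (hf : FlatOn Set.univ v)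
    (hv : ∀ x γ, Continuous γ → (∀ t, γ t ∈ chart x) →
      v γ = triv δ H x (γ 1) * (triv δ H x (γ 0))⁻¹) :
    v (sigma1 ∘ loopX) = (δ true)⁻¹ * δ false := by
  have hpi := Real.pi_pos
  let P : ℝ → C2Cover := fun θ => ⟨(Circle.exp θ, 1, 1), sigma1_mem (Circle.exp θ, 1)⟩
  let γ : ℝ → C2 := fun θ => proj (P θ)
  have hγ : Continuous γ := continuous_proj.comp (Continuous.subtype_mk (by fun_prop) _)
  have e : sigma1 ∘ loopX = γ ∘ segmentMap 0 (2 * π) := by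
    funext t
    change proj (P (2 * π * t)) = proj (P (segmentMap 0 (2 * π) t))
    rw [segmentMap_zero_left]
  have im : ∀ θ, ((P θ).1.1 : ℂ).im = sin θ := circle_exp_im
  have re : ∀ θ, ((P θ).1.1 : ℂ).re = cos θ := circle_exp_re
  have fim : ∀ θ, ((flip (P θ)).1.1 : ℂ).im = -sin θ := fun θ => by
    rw [← im]; simp [flip]
  have tt : ∀ θ, (P θ).1.2.1 = 1 := fun θ => rfl
  have hw : ∀ θ, (P θ).1.2.2 ≠ fibrePole true := fun θ => one_ne_neg_one_circle
  have sin4 : 0 < sin (π / 4) := sin_pos_of_pos_of_lt_pi (by linarith) (by linarith)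
  have m : ∀ a b c : ℝ, v (γ ∘ segmentMap b c) * v (γ ∘ segmentMap a b) = v (γ ∘ segmentMap a c) :=
    fun a b c => hf.interval convex_univ hγ.continuousOn (fun _ _ => trivial) trivial trivial
      trivial
  have s1 : v (γ ∘ segmentMap 0 (π / 4)) = _ := transport_interval hv (some true, true) hγ
    (by linarith) fun θ h => mem_chart_iff.2 ⟨Or.inl ⟨one_pos, by
      rw [re]; exact cos_pos_of_mem_Ioo ⟨by linarith [h.1], by linarith [h.2]⟩⟩, hw θ⟩
  have s2 : v (γ ∘ segmentMap (π / 4) (3 * π / 4)) = _ := transport_interval hv (none, true) hγ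
    (by linarith) fun θ h => mem_chart_iff.2 ⟨Or.inl (by
      change 0 < ((P θ).1.1 : ℂ).im
      rw [im]; exact sin_pos_of_pos_of_lt_pi (by linarith [h.1]) (by linarith [h.2])), hw θ⟩
  have s3 : v (γ ∘ segmentMap (3 * π / 4) (5 * π / 4)) = _ :=
    transport_interval hv (some false, true) hγ
    (by linarith) fun θ h => mem_chart_iff.2 ⟨Or.inl ⟨one_pos, by
      rw [re]; exact cos_neg_of_pi_div_two_lt_of_lt (by linarith [h.1]) (by linarith [h.2])⟩, hw θ⟩
  have s4 : v (γ ∘ segmentMap (5 * π / 4) (7 * π / 4)) = _ := transport_interval hv (none, true) hγ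
    (by linarith) fun θ h => mem_chart_iff.2 ⟨Or.inr (by
      change 0 < ((flip (P θ)).1.1 : ℂ).im
      rw [fim, ← sin_sub_pi]
      exact sin_pos_of_pos_of_lt_pi (by linarith [h.1]) (by linarith [h.2])), hw θ⟩
  have s5 : v (γ ∘ segmentMap (7 * π / 4) (2 * π)) = _ :=
    transport_interval hv (some true, true) hγ
    (by linarith) fun θ h => mem_chart_iff.2 ⟨Or.inl ⟨one_pos, by
      rw [re, ← cos_sub_two_pi]
      exact cos_pos_of_mem_Ioo ⟨by linarith [h.1], by linarith [h.2]⟩⟩, hw θ⟩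
  rw [e, ← m 0 (7 * π / 4), ← m 0 (5 * π / 4), ← m 0 (3 * π / 4), ← m 0 (π / 4),
    s1, s2, s3, s4, s5]
  have u0 : Upper (P 0) := Or.inr Circle.exp_zero
  have u1 : Upper (P (π / 4)) := Or.inl (by rw [im]; exact sin4)
  have u3 : Upper (P (3 * π / 4)) := Or.inl (by
    rw [im]; exact sin_pos_of_pos_of_lt_pi (by linarith) (by linarith))
  have u5 : ¬ Upper (P (5 * π / 4)) := not_upper_of_im_neg (by
    rw [im, show 5 * π / 4 = π / 4 + π by ring, sin_add_pi]; linarith)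
  have u7 : ¬ Upper (P (7 * π / 4)) := not_upper_of_im_neg (by
    rw [im, show 7 * π / 4 = 2 * π - π / 4 by ring, sin_two_pi_sub]; linarith)
  have u8 : Upper (P (2 * π)) := Or.inr (Circle.exp_two_pi)
  simp only [γ]
  rw [triv_true_of_upper _ u0, triv_true_of_upper _ u1, triv_true_of_upper _ u1,
    triv_true_of_upper _ u3, triv_true_of_upper _ u3, triv_true_of_not_upper _ u5,
    triv_true_of_not_upper _ u5, triv_true_of_not_upper _ u7, triv_true_of_not_upper _ u7,
    triv_true_of_upper _ u8]
  simp only [tt, baseTriv]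
  norm_num

-- The walls `false` and `true` are crossed at θ = π/2 and θ = 3π/2, both times from the side with t
-- < 0 of the representative to the side with t > 0; hence two inverses.
open Real in
theorem transport_sigma2_loopX (hf : FlatOn Set.univ v)
    (hv : ∀ x γ, Continuous γ → (∀ t, γ t ∈ chart x) →
      v γ = triv δ H x (γ 1) * (triv δ H x (γ 0))⁻¹) :
    v (sigma2 ∘ loopX) = (δ true)⁻¹ * (δ false)⁻¹ := by
  have hpi := Real.pi_pos
  let P : ℝ → C2Cover := fun θ => ⟨_, sigma2_mem (Circle.exp θ, 1)⟩
  let γ : ℝ → C2 := fun θ => proj (P θ)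
  have hγ : Continuous γ := continuous_proj.comp (Continuous.subtype_mk
    ((continuous_neg_circle.comp (by fun_prop)).prodMk (by fun_prop)) _)
  have e : sigma2 ∘ loopX = γ ∘ segmentMap 0 (2 * π) := by
    funext t
    change proj (P (2 * π * t)) = proj (P (segmentMap 0 (2 * π) t))
    rw [segmentMap_zero_left]
  have im : ∀ θ, ((P θ).1.1 : ℂ).im = -sin (cos θ / 2) := fun θ => by
    change (-(Circle.exp ((Circle.exp θ : ℂ).re / 2) : ℂ)).im = _
    rw [Complex.neg_im, circle_exp_im, circle_exp_re]
  have re : ∀ θ, ((P θ).1.1 : ℂ).re = -cos (cos θ / 2) := fun θ => by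
    change (-(Circle.exp ((Circle.exp θ : ℂ).re / 2) : ℂ)).re = _
    rw [Complex.neg_re, circle_exp_re, circle_exp_re]
  have re_neg : ∀ θ, ((P θ).1.1 : ℂ).re < 0 := fun θ => by
    rw [re, neg_lt_zero]
    exact cos_pos_of_mem_Ioo ⟨by linarith [neg_one_le_cos θ, pi_gt_three],
      by linarith [cos_le_one θ, pi_gt_three]⟩
  have im_neg : ∀ θ, 0 < cos θ → ((P θ).1.1 : ℂ).im < 0 := fun θ h => by
    rw [im, neg_lt_zero]
    exact sin_pos_of_pos_of_lt_pi (by linarith) (by linarith [cos_le_one θ, pi_gt_three])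
  have im_pos : ∀ θ, cos θ < 0 → 0 < ((P θ).1.1 : ℂ).im := fun θ h => by
    rw [im, neg_pos]
    exact sin_neg_of_neg_of_neg_pi_lt (by linarith) (by linarith [neg_one_le_cos θ, pi_gt_three])
  have tt : ∀ θ, (P θ).1.2.1 = sin θ / 2 := fun θ => by
    change (Circle.exp θ : ℂ).im / 2 = _
    rw [circle_exp_im]
  have fim : ∀ θ, ((flip (P θ)).1.1 : ℂ).im = -((P θ).1.1 : ℂ).im := fun θ => by simp [flip]
  have fre : ∀ θ, ((flip (P θ)).1.1 : ℂ).re = -((P θ).1.1 : ℂ).re := fun θ => by simp [flip]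
  have hw : ∀ θ, (P θ).1.2.2 ≠ fibrePole true := fun θ => one_ne_neg_one_circle
  have m : ∀ a b c : ℝ, v (γ ∘ segmentMap b c) * v (γ ∘ segmentMap a b) = v (γ ∘ segmentMap a c) :=
    fun a b c => hf.interval convex_univ hγ.continuousOn (fun _ _ => trivial) trivial trivial
      trivial
  have c1 : ∀ θ ∈ Set.Icc 0 (π / 4), 0 < cos θ := fun θ h =>
    cos_pos_of_mem_Ioo ⟨by linarith [h.1], by linarith [h.2]⟩
  have c2 : ∀ θ ∈ Set.Icc (π / 4) (3 * π / 4), 0 < sin θ := fun θ h =>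
    sin_pos_of_pos_of_lt_pi (by linarith [h.1]) (by linarith [h.2])
  have c3 : ∀ θ ∈ Set.Icc (3 * π / 4) (5 * π / 4), cos θ < 0 := fun θ h =>
    cos_neg_of_pi_div_two_lt_of_lt (by linarith [h.1]) (by linarith [h.2])
  have c4 : ∀ θ ∈ Set.Icc (5 * π / 4) (7 * π / 4), sin θ < 0 := fun θ h => by
    rw [← neg_pos, ← sin_sub_pi]
    exact sin_pos_of_pos_of_lt_pi (by linarith [h.1]) (by linarith [h.2])
  have c5 : ∀ θ ∈ Set.Icc (7 * π / 4) (2 * π), 0 < cos θ := fun θ h => by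
    rw [← cos_sub_two_pi]
    exact cos_pos_of_mem_Ioo ⟨by linarith [h.1], by linarith [h.2]⟩
  have s1 : v (γ ∘ segmentMap 0 (π / 4)) = _ := transport_interval hv (none, true) hγ
    (by linarith) fun θ h => mem_chart_iff.2 ⟨Or.inr (by
      change 0 < ((flip (P θ)).1.1 : ℂ).im
      rw [fim]; linarith [im_neg θ (c1 θ h)]), hw θ⟩
  have s2 : v (γ ∘ segmentMap (π / 4) (3 * π / 4)) = _ :=
    transport_interval hv (some false, true) hγ
    (by linarith) fun θ h => mem_chart_iff.2 ⟨Or.inl ⟨by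
      rw [tt]; linarith [c2 θ h], re_neg θ⟩, hw θ⟩
  have s3 : v (γ ∘ segmentMap (3 * π / 4) (5 * π / 4)) = _ :=
    transport_interval hv (none, true) hγ
    (by linarith) fun θ h => mem_chart_iff.2 ⟨Or.inl (im_pos θ (c3 θ h)), hw θ⟩
  have s4 : v (γ ∘ segmentMap (5 * π / 4) (7 * π / 4)) = _ :=
    transport_interval hv (some true, true) hγ
    (by linarith) fun θ h => mem_chart_iff.2 ⟨Or.inr ⟨by
      change 0 < -(P θ).1.2.1
      rw [tt]; linarith [c4 θ h], by rw [fre]; linarith [re_neg θ]⟩, hw θ⟩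
  have s5 : v (γ ∘ segmentMap (7 * π / 4) (2 * π)) = _ :=
    transport_interval hv (none, true) hγ
    (by linarith) fun θ h => mem_chart_iff.2 ⟨Or.inr (by
      change 0 < ((flip (P θ)).1.1 : ℂ).im
      rw [fim]; linarith [im_neg θ (c5 θ h)]), hw θ⟩
  have m1 : π / 4 ∈ Set.Icc (π / 4) (3 * π / 4) := Set.left_mem_Icc.2 (by linarith)
  have m3 : 3 * π / 4 ∈ Set.Icc (π / 4) (3 * π / 4) := Set.right_mem_Icc.2 (by linarith)
  have m5 : 5 * π / 4 ∈ Set.Icc (5 * π / 4) (7 * π / 4) := Set.left_mem_Icc.2 (by linarith)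
  have m7 : 7 * π / 4 ∈ Set.Icc (5 * π / 4) (7 * π / 4) := Set.right_mem_Icc.2 (by linarith)
  have u1 : ¬ Upper (P (π / 4)) := not_upper_of_im_neg (im_neg _ (c1 _ (by
    constructor <;> linarith)))
  have u3 : Upper (P (3 * π / 4)) := Or.inl (im_pos _ (c3 _ (by constructor <;> linarith)))
  have u5 : Upper (P (5 * π / 4)) := Or.inl (im_pos _ (c3 _ (by constructor <;> linarith)))
  have u7 : ¬ Upper (P (7 * π / 4)) := not_upper_of_im_neg (im_neg _ (c5 _ (by
    constructor <;> linarith)))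
  have tn : ∀ q, triv δ H (none, true) q = 1 := fun q => by simp [triv, fibreTriv, baseTriv]
  rw [e, ← m 0 (7 * π / 4), ← m 0 (5 * π / 4), ← m 0 (3 * π / 4), ← m 0 (π / 4),
    s1, s2, s3, s4, s5, tn, tn, tn, tn, tn, tn]
  have q1 : triv δ H (some false, true) (γ (π / 4)) = δ false := by
    rw [triv_true_of_not_upper _ u1, tt, baseTriv_some_of_neg _ _ (by linarith [c2 _ m1])]
    simp
  have q3 : triv δ H (some false, true) (γ (3 * π / 4)) = 1 := by
    rw [triv_true_of_upper _ u3, tt, baseTriv_some_of_pos _ _ (by linarith [c2 _ m3])]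
  have q5 : triv δ H (some true, true) (γ (5 * π / 4)) = δ true := by
    rw [triv_true_of_upper _ u5, tt, baseTriv_some_of_neg _ _ (by linarith [c4 _ m5])]
    simp
  have q7 : triv δ H (some true, true) (γ (7 * π / 4)) = 1 := by
    rw [triv_true_of_not_upper _ u7, tt, baseTriv_some_of_pos _ _ (by linarith [c4 _ m7])]
  rw [q1, q3, q5, q7]
  simp

-- The arc starts past u = -1, so it meets the wall `true` only, at its end.
open Real in
theorem transport_arc (hf : FlatOn Set.univ v)
    (hv : ∀ x γ, Continuous γ → (∀ t, γ t ∈ chart x) →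
      v γ = triv δ H x (γ 1) * (triv δ H x (γ 0))⁻¹) :
    v (sigma1 ∘ arc) = (δ true)⁻¹ := by
  have hpi := Real.pi_gt_three
  let P : ℝ → C2Cover := fun θ => ⟨(Circle.exp θ, 1, 1), sigma1_mem (Circle.exp θ, 1)⟩
  let γ : ℝ → C2 := fun θ => proj (P θ)
  have hγ : Continuous γ := continuous_proj.comp (Continuous.subtype_mk (by fun_prop) _)
  have hw : ∀ θ, (P θ).1.2.2 ≠ fibrePole true := fun θ => one_ne_neg_one_circle
  have m : ∀ a b c : ℝ, v (γ ∘ segmentMap b c) * v (γ ∘ segmentMap a b) = v (γ ∘ segmentMap a c) :=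
    fun a b c => hf.interval convex_univ hγ.continuousOn (fun _ _ => trivial) trivial trivial
      trivial
  have s4 : v (γ ∘ segmentMap (π + 1 / 2) (7 * π / 4)) = _ :=
    transport_interval hv (none, true) hγ
    (by linarith) fun θ h => mem_chart_iff.2 ⟨Or.inr (by
      change 0 < (-(Circle.exp θ : ℂ)).im
      rw [Complex.neg_im, circle_exp_im, ← sin_sub_pi]
      exact sin_pos_of_pos_of_lt_pi (by linarith [h.1]) (by linarith [h.2])), hw θ⟩
  have s5 : v (γ ∘ segmentMap (7 * π / 4) (2 * π)) = _ :=
    transport_interval hv (some true, true) hγ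
    (by linarith) fun θ h => mem_chart_iff.2 ⟨Or.inl ⟨one_pos, by
      change 0 < (Circle.exp θ : ℂ).re
      rw [circle_exp_re, ← cos_sub_two_pi]
      exact cos_pos_of_mem_Ioo ⟨by linarith [h.1], by linarith [h.2]⟩⟩, hw θ⟩
  change v (γ ∘ segmentMap (π + 1 / 2) (2 * π)) = _
  rw [← m _ (7 * π / 4), s4, s5]
  have u7 : ¬ Upper (P (7 * π / 4)) := not_upper_of_im_neg (by
    change (Circle.exp (7 * π / 4) : ℂ).im < 0
    rw [circle_exp_im, show 7 * π / 4 = 2 * π - π / 4 by ring, sin_two_pi_sub, neg_lt_zero]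
    exact sin_pos_of_pos_of_lt_pi (by linarith) (by linarith))
  have u8 : Upper (P (2 * π)) := Or.inr (Circle.exp_two_pi)
  have tn : ∀ q, triv δ H (none, true) q = 1 := fun q => by simp [triv, fibreTriv, baseTriv]
  rw [tn, tn, triv_true_of_not_upper _ u7, triv_true_of_upper _ u8,
    baseTriv_some_of_pos _ _ (show (0 : ℝ) < (P (2 * π)).1.2.1 from one_pos),
    baseTriv_some_of_neg _ _ (show -(P (7 * π / 4)).1.2.1 < 0 from by norm_num [P])]
  simp

theorem transport_vert
    (hv : ∀ x γ, Continuous γ → (∀ t, γ t ∈ chart x) →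
      v γ = triv δ H x (γ 1) * (triv δ H x (γ 0))⁻¹) {s : unitInterval → unitInterval}
    (hs : Continuous s) : v (vert ∘ s) = 1 := by
  rw [hv (none, true) _ (continuous_vert.comp hs) fun t => mem_chart_iff.2 ⟨Or.inr (by
    change 0 < (- -(Circle.exp (1 / 2) : ℂ)).im
    rw [neg_neg, circle_exp_im]
    exact Real.sin_pos_of_pos_of_lt_pi (by norm_num) (by linarith [Real.pi_gt_three])),
    one_ne_neg_one_circle⟩]
  simp [triv, fibreTriv, baseTriv]

end Holonomy

/-- The flat transports on `C₂`, that is, the representations of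
`⟨x₁, x₂, z, h | [x₁, h], [x₂, h], x₁ x₂ z², z h z⁻¹ h⟩`. -/
theorem exists_flatOn {G : Type*} [Group G] {X₁ W H : G} (hX : X₁ * H = H * X₁)
    (hW : W * H * W⁻¹ = H⁻¹) :
    ∃ v : (unitInterval → C2) → G, FlatOn Set.univ v ∧ v (sigma1 ∘ loopX) = X₁ ∧
      v (sigma1 ∘ loopH) = H ∧
      (∀ s : unitInterval → unitInterval, Continuous s → v (vert ∘ s) = 1) ∧
      ∃ g, v (sigma2 ∘ loopX) = g * (W * W * X₁⁻¹) * g⁻¹ ∧ v (sigma2 ∘ loopH) = g * H * g⁻¹ ∧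
        v (sigma1 ∘ arc) * g = X₁ := by
  classical
  have hW' : W⁻¹ * H * W = H⁻¹ := by
    have := congrArg (fun g => W⁻¹ * g⁻¹ * W) hW
    rw [inv_inv] at this
    rw [← this]
    group
  have hX' : X₁ * H * X₁⁻¹ = H := by rw [hX, mul_inv_cancel_right]
  have hX'' : X₁⁻¹ * H * X₁ = H := by rw [mul_assoc, ← hX, inv_mul_cancel_left]
  have hXi : X₁ * H⁻¹ * X₁⁻¹ = H⁻¹ := by
    rw [show X₁ * H⁻¹ * X₁⁻¹ = (X₁ * H * X₁⁻¹)⁻¹ by group, hX']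
  have h1 : (X₁ * W⁻¹) * H * (X₁ * W⁻¹)⁻¹ = H⁻¹ := by
    rw [show (X₁ * W⁻¹) * H * (X₁ * W⁻¹)⁻¹ = X₁ * (W⁻¹ * H * W) * X₁⁻¹ by group, hW', hXi]
  have h2 : (X₁ * W⁻¹ * X₁⁻¹) * H * (X₁ * W⁻¹ * X₁⁻¹)⁻¹ = H⁻¹ := by
    rw [show (X₁ * W⁻¹ * X₁⁻¹) * H * (X₁ * W⁻¹ * X₁⁻¹)⁻¹ =
      X₁ * (W⁻¹ * (X₁⁻¹ * H * X₁) * W) * X₁⁻¹ by group, hX'', hW', hXi]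
  -- The holonomy (δ true)⁻¹ δ false of x₁ must equal X₁, which leaves one free parameter. It is
  -- normalized so that x₂ has holonomy W² X₁⁻¹ conjugated by g = X₁ W⁻¹.
  obtain ⟨v, hf, hv⟩ := exists_flatOn_triv (H := H)
    (δ := fun b => if b then X₁ * W⁻¹ * X₁⁻¹ else X₁ * W⁻¹) (by
      rintro (_ | _)
      · simpa using h1
      · simpa using h2)
  refine ⟨v, hf, ?_, ?_, fun s hs => transport_vert hv hs, X₁ * W⁻¹, ?_, ?_, ?_⟩
  · rw [transport_sigma1_loopX hf hv]
    simp [mul_assoc]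
  · have := transport_fibre hf hv ⟨(1, 1, 1), sigma1_mem (1, 1)⟩
    have hu : Upper ⟨(1, 1, 1), sigma1_mem (1, 1)⟩ := Or.inr rfl
    rwa [if_pos hu] at this
  · rw [transport_sigma2_loopX hf hv]
    simp [mul_assoc]
  · have := transport_fibre hf hv ⟨_, sigma2_mem (1, 1)⟩
    rw [if_neg (not_upper_of_im_neg (by
      change (-(Circle.exp (((1 : Circle) : ℂ).re / 2) : ℂ)).im < 0
      rw [Complex.neg_im, circle_exp_im, neg_lt_zero, Circle.coe_one, Complex.one_re]
      exact Real.sin_pos_of_pos_of_lt_pi (by norm_num) (by linarith [Real.pi_gt_three])))] at this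
    rw [h1]
    exact this
  · rw [transport_arc hf hv]
    simp [mul_assoc]

end C2

/-! ### Gluing on `Y = Y₁ ∪ C₂` -/

/-- The map `[-1, 1] → [-1, 1]` which is the identity on `[-1/2, 1/2]` and stretches
`[1/2, 3/4]` onto `[1/2, 1]`. -/
def stretchReal (t : ℝ) : ℝ := max (-1) (min 1 (t + (max 0 (t - 1 / 2) + min 0 (t + 1 / 2))))

theorem continuous_stretchReal : Continuous stretchReal := by
  unfold stretchReal; fun_prop

theorem stretchReal_neg (t : ℝ) : stretchReal (-t) = -stretchReal t := by
  unfold stretchReal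
  grind

theorem stretchReal_of_abs_le {t : ℝ} (h : |t| ≤ 1 / 2) : stretchReal t = t := by
  unfold stretchReal
  grind

theorem stretchReal_of_le {t : ℝ} (h : 3 / 4 ≤ t) : stretchReal t = 1 := by
  unfold stretchReal
  grind

theorem abs_stretchReal_le (t : ℝ) : |stretchReal t| ≤ 1 := by
  unfold stretchReal
  grind

/-- Moving away from t = 0 never enters a removed disc, so the stretch acts on `C2Cover`. -/
theorem abs_le_abs_stretchReal {t : ℝ} (h : |t| ≤ 1) : |t| ≤ |stretchReal t| := by
  unfold stretchReal
  grind

namespace C2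

/-- The stretching map on the cover. -/
def stretchCover (p : C2Cover) : C2Cover :=
  ⟨(p.1.1, stretchReal p.1.2.1, p.1.2.2), abs_stretchReal_le _, fun s hs => by
    have h1 := p.2.2 s hs
    have h2 := sq_le_sq.2 (abs_le_abs_stretchReal p.2.1)
    simp only at h1 ⊢
    linarith⟩

theorem continuous_stretchCover : Continuous stretchCover :=
  Continuous.subtype_mk ((by fun_prop : Continuous fun p : C2Cover => p.1.1).prodMk
    ((continuous_stretchReal.comp (by fun_prop)).prodMk (by fun_prop))) _

theorem stretchCover_flip (p : C2Cover) : stretchCover (flip p) = flip (stretchCover p) := by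
  apply Subtype.ext
  simp [stretchCover, flip, stretchReal_neg]

/-- The stretching map: it maps a collar of `Σ₁'` to `Σ₁'` and is the identity on `Σ₂'`. -/
def stretch : C2 → C2 :=
  Quotient.lift (fun p => proj (stretchCover p)) (by
    intro p q h
    rcases proj_eq_proj_iff.1 (Quotient.sound h) with rfl | rfl
    · rfl
    · rw [stretchCover_flip, proj_flip])

theorem continuous_stretch : Continuous stretch :=
  isQuotientMap_proj.continuous_iff.2 (continuous_proj.comp continuous_stretchCover)

theorem stretch_sigma1 (p : Torus) : stretch (sigma1 p) = sigma1 p := by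
  refine congrArg proj (Subtype.ext ?_)
  simp [stretchCover, stretchReal_of_le (show (3 / 4 : ℝ) ≤ 1 by norm_num)]

theorem stretch_sigma2 (p : Torus) : stretch (sigma2 p) = sigma2 p := by
  refine congrArg proj (Subtype.ext ?_)
  have : |(p.1 : ℂ).im / 2| ≤ 1 / 2 := by
    have h1 := Complex.abs_im_le_norm (p.1 : ℂ)
    rw [Circle.norm_coe] at h1
    rw [abs_div, abs_two]
    linarith
  simp [stretchCover, stretchReal_of_abs_le this]

/-- The complement of an open collar of `Σ₁'`. -/
def core : Set C2 := proj '' {p | |p.1.2.1| ≤ 3 / 4}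

theorem mem_core_iff {p : C2Cover} : proj p ∈ core ↔ |p.1.2.1| ≤ 3 / 4 := by
  constructor
  · rintro ⟨q, hq, h⟩
    rcases proj_eq_proj_iff.1 h with rfl | rfl
    · exact hq
    · simpa [flip] using hq
  · exact fun h => ⟨p, h, rfl⟩

theorem isClosed_core : IsClosed core := by
  rw [← isQuotientMap_proj.isClosed_preimage]
  have : proj ⁻¹' core = {p | |p.1.2.1| ≤ 3 / 4} := Set.ext fun p => mem_core_iff
  rw [this]
  exact isClosed_le (by fun_prop) continuous_const

theorem stretch_mem_of_not_mem_core {q : C2} (h : q ∉ core) : stretch q ∈ Set.range sigma1 := by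
  obtain ⟨p, rfl⟩ := proj_surjective q
  have hp : 3 / 4 < |p.1.2.1| := not_le.1 (mt mem_core_iff.2 h)
  rcases lt_abs.1 hp with hp | hp
  · refine ⟨(p.1.1, p.1.2.2), congrArg proj (Subtype.ext ?_)⟩
    simp [stretchCover, stretchReal_of_le hp.le]
  · refine ⟨(-p.1.1, p.1.2.2⁻¹), ?_⟩
    rw [← proj_flip p]
    refine congrArg proj (Subtype.ext ?_)
    simp [stretchCover, flip, stretchReal_of_le hp.le]

theorem sigma1_not_mem_core (p : Torus) : sigma1 p ∉ core := fun h => by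
  have := mem_core_iff.1 h
  norm_num at this

theorem sigma2_mem_core (p : Torus) : sigma2 p ∈ core := by
  refine mem_core_iff.2 ?_
  have h1 := Complex.abs_im_le_norm (p.1 : ℂ)
  rw [Circle.norm_coe] at h1
  change |(p.1 : ℂ).im / 2| ≤ 3 / 4
  rw [abs_div, abs_two]
  linarith

theorem proj_not_mem_range_sigma1 {p : C2Cover} (h : |p.1.2.1| < 1) :
    proj p ∉ Set.range sigma1 := by
  rintro ⟨q, hq⟩
  rcases proj_eq_proj_iff.1 hq with rfl | rfl
  · norm_num at h
  · norm_num [flip] at h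

theorem continuous_sigma1 : Continuous sigma1 :=
  continuous_proj.comp (Continuous.subtype_mk (by fun_prop) _)

theorem continuous_sigma2 : Continuous sigma2 :=
  continuous_proj.comp (Continuous.subtype_mk
    ((continuous_neg_circle.comp (by fun_prop)).prodMk (by fun_prop)) _)

end C2

namespace UnionC2

variable {Y₁ Y : Type*} [TopologicalSpace Y₁] [ChartedSpace (EuclideanHalfSpace 3) Y₁]
  [TopologicalSpace Y] [ChartedSpace (EuclideanHalfSpace 3) Y] (D : UnionC2 Y₁ Y)

open Classical in
/-- The map `Y → Y` which is the identity on `Y₁` and stretches `C₂`. -/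
def stretch (y : Y) : Y :=
  if h : ∃ q, D.k q = y then D.k (C2.stretch h.choose) else y

theorem stretch_k (q : C2) : D.stretch (D.k q) = D.k (C2.stretch q) := by
  have h : ∃ q', D.k q' = D.k q := ⟨q, rfl⟩
  rw [stretch, dif_pos h, D.isClosedEmbedding_k.injective h.choose_spec]

theorem exists_of_j_eq_k {a : Y₁} {q : C2} (h : D.j a = D.k q) :
    ∃ p, q = sigma1 p ∧ a = (D.e₁ p : Y₁) := by
  have hm : D.k q ∈ Set.range D.j ∩ Set.range D.k := ⟨⟨a, h⟩, ⟨q, rfl⟩⟩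
  rw [D.inter] at hm
  obtain ⟨_, ⟨p, rfl⟩, hp⟩ := hm
  exact ⟨p, (D.isClosedEmbedding_k.injective hp).symm,
    D.isClosedEmbedding_j.injective (by rw [h, D.j_e₁, hp])⟩

theorem stretch_j (a : Y₁) : D.stretch (D.j a) = D.j a := by
  by_cases h : ∃ q, D.k q = D.j a
  · obtain ⟨q, hq⟩ := h
    obtain ⟨p, rfl, rfl⟩ := D.exists_of_j_eq_k hq.symm
    rw [← hq, stretch_k, C2.stretch_sigma1]
  · rw [stretch, dif_neg h]

theorem eq_j_or_eq_k (y : Y) : (∃ a, D.j a = y) ∨ ∃ q, D.k q = y := by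
  have : y ∈ Set.range D.j ∪ Set.range D.k := D.cover ▸ Set.mem_univ y
  exact this

theorem continuous_stretch : Continuous D.stretch := by
  refine continuous_iff_isClosed.2 fun C hC => ?_
  have : D.stretch ⁻¹' C = D.j '' (D.j ⁻¹' C) ∪ D.k '' ((fun q => D.k (C2.stretch q)) ⁻¹' C) := by
    ext y
    constructor
    · intro hy
      rcases D.eq_j_or_eq_k y with ⟨a, rfl⟩ | ⟨q, rfl⟩
      · exact Or.inl ⟨a, by simpa [stretch_j] using hy, rfl⟩
      · exact Or.inr ⟨q, by simpa [stretch_k] using hy, rfl⟩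
    · rintro (⟨a, ha, rfl⟩ | ⟨q, hq, rfl⟩)
      · simpa [stretch_j] using ha
      · simpa [stretch_k] using hq
  rw [this]
  exact (D.isClosedEmbedding_j.isClosedMap _ (hC.preimage D.isClosedEmbedding_j.continuous)).union
    (D.isClosedEmbedding_k.isClosedMap _
      (hC.preimage (D.isClosedEmbedding_k.continuous.comp C2.continuous_stretch)))

/-- This makes a collar of ∂Y₁ in Y₁ unnecessary: Y₁ is thickened into C₂, and the stretch retracts
the thickening onto Y₁. -/
theorem stretch_mem_range_j {y : Y} (h : y ∉ D.k '' C2.core) : D.stretch y ∈ Set.range D.j := by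
  rcases D.eq_j_or_eq_k y with ⟨a, rfl⟩ | ⟨q, rfl⟩
  · exact ⟨a, (D.stretch_j a).symm⟩
  · obtain ⟨p, hp⟩ := C2.stretch_mem_of_not_mem_core (q := q) fun hq => h ⟨q, hq, rfl⟩
    exact ⟨D.e₁ p, by rw [D.j_e₁, hp, stretch_k]⟩

theorem stretch_mem_range_k {y : Y} (h : y ∉ Set.range D.j) : D.stretch y ∈ Set.range D.k := by
  rcases D.eq_j_or_eq_k y with h' | ⟨q, rfl⟩
  · exact (h h').elim
  · exact ⟨_, (D.stretch_k q).symm⟩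

variable {G : Type*} [Group G]

/-- Flat transports on `Y₁` and on `C₂` which agree on `Σ₁'` glue to a flat transport on `Y`. -/
theorem exists_flatOn_of_agree {v₁ : (unitInterval → Y₁) → G} {v₂ : (unitInterval → C2) → G}
    (h₁ : FlatOn Set.univ v₁) (h₂ : FlatOn Set.univ v₂)
    (hagree : ∀ τ : unitInterval → Torus, Continuous τ →
      v₁ (fun t => (D.e₁ (τ t) : Y₁)) = v₂ (sigma1 ∘ τ)) :
    ∃ v : (unitInterval → Y) → G, FlatOn Set.univ v ∧
      (∀ γ : unitInterval → Y, Continuous γ → (∀ t, γ t ∉ D.k '' C2.core) →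
        ∀ δ : unitInterval → Y₁, (∀ t, D.stretch (γ t) = D.j (δ t)) → v γ = v₁ δ) ∧
      (∀ γ : unitInterval → Y, Continuous γ → (∀ t, γ t ∉ Set.range D.j) →
        ∀ δ : unitInterval → C2, (∀ t, D.stretch (γ t) = D.k (δ t)) → v γ = v₂ δ) := by
  have : Nonempty Y₁ := ⟨D.e₁ (1, 1)⟩
  have : Nonempty C2 := ⟨sigma1 (1, 1)⟩
  let r₁ : Y → Y₁ := fun y => Function.invFun D.j (D.stretch y)
  let r₂ : Y → C2 := fun y => Function.invFun D.k (D.stretch y)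
  have hr₁ : ∀ y ∉ D.k '' C2.core, D.j (r₁ y) = D.stretch y := fun y hy =>
    Function.invFun_eq (D.stretch_mem_range_j hy)
  have hr₂ : ∀ y ∉ Set.range D.j, D.k (r₂ y) = D.stretch y := fun y hy =>
    Function.invFun_eq (D.stretch_mem_range_k hy)
  have c₁ : ContinuousOn r₁ (D.k '' C2.core)ᶜ :=
    D.isClosedEmbedding_j.isInducing.continuousOn_iff.2
      (D.continuous_stretch.continuousOn.congr hr₁)
  have c₂ : ContinuousOn r₂ (Set.range D.j)ᶜ :=
    D.isClosedEmbedding_k.isInducing.continuousOn_iff.2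
      (D.continuous_stretch.continuousOn.congr hr₂)
  let U : Bool → Set Y := fun b => if b then (D.k '' C2.core)ᶜ else (Set.range D.j)ᶜ
  let w : Bool → (unitInterval → Y) → G := fun b =>
    if b then fun γ => v₁ (r₁ ∘ γ) else fun γ => v₂ (r₂ ∘ γ)
  have hU : ∀ b, IsOpen (U b) := by
    rintro (_ | _)
    · exact D.isClosedEmbedding_j.isClosed_range.isOpen_compl
    · exact (D.isClosedEmbedding_k.isClosedMap _ C2.isClosed_core).isOpen_compl
  have hcov : ⋃ b, U b = Set.univ := by
    refine Set.eq_univ_of_forall fun y => ?_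
    by_cases hy : y ∈ Set.range D.j
    · refine Set.mem_iUnion.2 ⟨true, ?_⟩
      rintro ⟨q, hq, rfl⟩
      obtain ⟨a, ha⟩ := hy
      obtain ⟨p, rfl, -⟩ := D.exists_of_j_eq_k ha
      exact C2.sigma1_not_mem_core p hq
    · exact Set.mem_iUnion.2 ⟨false, hy⟩
  have hw : ∀ b, FlatOn (U b) (w b) := by
    rintro (_ | _)
    · exact h₂.comp c₂ fun _ _ => trivial
    · exact h₁.comp c₁ fun _ _ => trivial
  have key : ∀ γ : unitInterval → Y, Continuous γ → (∀ t, γ t ∈ U true) → (∀ t, γ t ∈ U false) →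
      w true γ = w false γ := by
    intro γ hγ ht hf
    -- On the overlap both stretched paths lie in Σ₁' = ∂Y₁, where the two transports agree.
    have hp : ∀ t, ∃ p, r₂ (γ t) = sigma1 p ∧ r₁ (γ t) = (D.e₁ p : Y₁) := fun t =>
      D.exists_of_j_eq_k ((hr₁ _ (ht t)).trans (hr₂ _ (hf t)).symm)
    choose p hp₂ hp₁ using hp
    have hpc : Continuous p := by
      have e : p = fun t => D.e₁.symm ⟨r₁ (γ t), by rw [hp₁]; exact (D.e₁ (p t)).2⟩ := by
        funext t
        rw [Homeomorph.eq_symm_apply]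
        exact Subtype.ext (hp₁ t).symm
      rw [e]
      exact D.e₁.symm.continuous.comp ((c₁.comp_continuous hγ ht).subtype_mk _)
    have := hagree p hpc
    have e₁ : r₁ ∘ γ = fun t => (D.e₁ (p t) : Y₁) := funext hp₁
    have e₂ : r₂ ∘ γ = sigma1 ∘ p := funext hp₂
    change v₁ (r₁ ∘ γ) = v₂ (r₂ ∘ γ)
    rw [e₁, e₂, this]
  obtain ⟨v, hv, hvU⟩ := exists_flatOn_univ_of_agree hU hcov hw (by
    rintro (_ | _) (_ | _) γ hγ ha hb
    · rfl
    · exact (key γ hγ hb ha).symm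
    · exact key γ hγ ha hb
    · rfl)
  refine ⟨v, hv, fun γ hγ h δ hδ => ?_, fun γ hγ h δ hδ => ?_⟩
  · rw [hvU true γ hγ h]
    change v₁ (r₁ ∘ γ) = _
    congr 1
    funext t
    exact D.isClosedEmbedding_j.injective ((hr₁ _ (h t)).trans (hδ t))
  · rw [hvU false γ hγ h]
    change v₂ (r₂ ∘ γ) = _
    congr 1
    funext t
    exact D.isClosedEmbedding_k.injective ((hr₂ _ (h t)).trans (hδ t))

end UnionC2

/-! ### Fibres of C₂ under transports with commuting values -/

namespace C2

theorem stretchReal_mem {r : ℝ} (h : r ∈ Set.Icc (0 : ℝ) 1) :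
    stretchReal r ∈ Set.Icc (0 : ℝ) 1 := by
  obtain ⟨h0, h1⟩ := h
  unfold stretchReal
  constructor <;> grind

theorem stretch_vert (r : unitInterval) :
    stretch (vert r) = vert ⟨stretchReal r, stretchReal_mem r.2⟩ :=
  rfl

/-- A transport with commuting values takes the same value on the fibres over the ends of a path
in the base. -/
theorem transport_fibre_eq_of_path {G : Type*} [Group G] {v : (unitInterval → C2) → G}
    (hv : FlatOn Set.univ v) (hc : ∀ γ γ', v γ * v γ' = v γ' * v γ) {B : ℝ → C2Cover}
    (hB : Continuous B) :
    v (fun t => proj (inFibre (B 0) (Circle.exp (2 * Real.pi * t)))) =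
      v (fun t => proj (inFibre (B 1) (Circle.exp (2 * Real.pi * t)))) := by
  let F : ℝ × ℝ → C2 := fun x => proj (inFibre (B x.1) (Circle.exp (2 * Real.pi * x.2)))
  have hF : Continuous F := continuous_proj.comp (Continuous.subtype_mk (by fun_prop) _)
  have h := hv.square hF.continuousOn fun _ _ => trivial
  have e : (fun t : unitInterval => F (t, 0)) = fun t : unitInterval => F (t, 1) := by
    funext t
    simp [F]
  rw [e, hc] at h
  exact (mul_left_cancel h).symm

/-- The two loops have the same image in C₂ and run in opposite directions, because the involution
inverts the fibre coordinate. -/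
theorem transport_fibre_flip {G : Type*} [Group G] {v : (unitInterval → C2) → G}
    (hv : FlatOn Set.univ v) (p : C2Cover) :
    v (fun t => proj (inFibre (flip p) (Circle.exp (2 * Real.pi * t)))) =
      (v (fun t => proj (inFibre p (Circle.exp (2 * Real.pi * t)))))⁻¹ := by
  let γ : ℝ → C2 := fun θ => proj (inFibre p (Circle.exp θ))
  have hγ : Continuous γ := continuous_proj.comp ((continuous_inFibre p).comp
    Circle.exp.continuous)
  have h := hv.interval convex_univ hγ.continuousOn (fun _ _ => trivial) (Set.mem_univ 0)
    (Set.mem_univ (2 * Real.pi)) (Set.mem_univ 0)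
  have e₁ : γ ∘ segmentMap 0 (2 * Real.pi) =
      fun t : unitInterval => proj (inFibre p (Circle.exp (2 * Real.pi * t))) := by
    funext t
    simp only [γ, Function.comp_apply, segmentMap_zero_left]
  have e₂ : γ ∘ segmentMap (2 * Real.pi) 0 =
      fun t : unitInterval => proj (inFibre (flip p) (Circle.exp (2 * Real.pi * t))) := by
    funext t
    rw [← proj_flip]
    refine congrArg proj (Subtype.ext ?_)
    have : segmentMap (2 * Real.pi) 0 t = -(2 * Real.pi * t) + 2 * Real.pi := by
      simp [segmentMap, AffineMap.lineMap_apply]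
      ring
    simp [flip, inFibre, this, Circle.exp_add, Circle.exp_neg]
  rw [segmentMap_self] at h
  rw [e₁, e₂, show γ ∘ (fun _ : unitInterval => (0 : ℝ)) = fun _ => γ 0 from rfl,
    hv.const (Set.mem_univ _)] at h
  exact eq_inv_of_mul_eq_one_left h

/-- The base point is moved vertically from t = 0 to t = 1, and then along Σ₁' to u = 1. -/
theorem transport_fibre_eq_sigma1 {G : Type*} [Group G] {v : (unitInterval → C2) → G}
    (hv : FlatOn Set.univ v) (hc : ∀ γ γ', v γ * v γ' = v γ' * v γ) {u : Circle}
    (h : (u, 0, 1) ∈ C2Cover) :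
    v (fun t => proj (inFibre ⟨(u, 0, 1), h⟩ (Circle.exp (2 * Real.pi * t)))) =
      v (sigma1 ∘ loopH) := by
  let π : ℝ → unitInterval := Set.projIcc 0 1 zero_le_one
  have hπ : Continuous π := continuous_projIcc
  have π0 : π 0 = 0 := Set.projIcc_left _
  have π1 : π 1 = 1 := Set.projIcc_right _
  have h₁ := transport_fibre_eq_of_path hv hc (B := fun r => ⟨(u, π r, 1), mem_of_mem_zero h
    (by rw [abs_of_nonneg (π r).2.1]; exact (π r).2.2)⟩) (Continuous.subtype_mk (by fun_prop) _)
  have h₂ := transport_fibre_eq_of_path hv hc (B := fun r => ⟨(Circle.exp (r * (u : ℂ).arg), 1, 1),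
    sigma1_mem (_, 1)⟩) (Continuous.subtype_mk (by fun_prop) _)
  simp only [π0, π1, Set.Icc.coe_zero, Set.Icc.coe_one, zero_mul, one_mul,
    Circle.exp_zero, Circle.exp_arg] at h₁ h₂
  exact h₁.trans h₂.symm

/-- The base point under Σ₂' and its flip are both at height 0, so both fibres can be moved to the
fibre of Σ₁'. They are inverse to each other, which is the relation z h z⁻¹ h = 1 for commuting
values. -/
theorem transport_abelian {G : Type*} [Group G] {v : (unitInterval → C2) → G}
    (hv : FlatOn Set.univ v) (hc : ∀ γ γ', v γ * v γ' = v γ' * v γ) :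
    v (sigma2 ∘ loopH) = v (sigma1 ∘ loopH) ∧ v (sigma2 ∘ loopH) * v (sigma2 ∘ loopH) = 1 := by
  have e : v (sigma2 ∘ loopH) = v (fun t =>
      proj (inFibre ⟨_, sigma2_base_mem⟩ (Circle.exp (2 * Real.pi * t)))) := by
    congr 1
    funext t
    refine congrArg proj (Subtype.ext ?_)
    simp [inFibre, loopH]
  have hf : flip ⟨_, sigma2_base_mem⟩ =
      ⟨(Circle.exp (1 / 2), 0, 1), by simpa [flip] using (flip ⟨_, sigma2_base_mem⟩).2⟩ := by
    apply Subtype.ext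
    simp [flip]
  have h₁ := transport_fibre_eq_sigma1 hv hc sigma2_base_mem
  have h₂ := transport_fibre_flip hv ⟨_, sigma2_base_mem⟩
  rw [hf, transport_fibre_eq_sigma1 hv hc, h₁] at h₂
  rw [e, h₁]
  refine ⟨rfl, ?_⟩
  nth_rw 1 [h₂]
  exact inv_mul_cancel _

end C2

/-! ### Extending representations from π₁(Y₁) to π₁(Y), and restricting them -/

namespace UnionC2

variable {Y₁ Y : Type*} [TopologicalSpace Y₁] [ChartedSpace (EuclideanHalfSpace 3) Y₁]
  [TopologicalSpace Y] [ChartedSpace (EuclideanHalfSpace 3) Y] (D : UnionC2 Y₁ Y)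
  {G : Type*} [Group G]

theorem j_not_mem (a : Y₁) : D.j a ∉ D.k '' C2.core := by
  rintro ⟨q, hq, h⟩
  obtain ⟨p, rfl, -⟩ := D.exists_of_j_eq_k h.symm
  exact C2.sigma1_not_mem_core p hq

theorem k_not_mem {q : C2} (h : q ∉ Set.range sigma1) : D.k q ∉ Set.range D.j := by
  rintro ⟨a, ha⟩
  obtain ⟨p, rfl, -⟩ := D.exists_of_j_eq_k ha
  exact h ⟨p, rfl⟩

theorem sigma2_not_mem_range (p : Torus) : sigma2 p ∉ Set.range sigma1 := by
  rintro ⟨q, hq⟩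
  exact C2.sigma1_not_mem_core q (hq ▸ C2.sigma2_mem_core p)

/-- The transport on `Y` given by a representation of `π₁(Y₁)` and a transport on `C₂` with the
same values on the basis of `π₁(Σ₁')`. -/
theorem exists_flatOn_of_hom (ρ₁ : PiM D.e₁ →* G) {v₂ : (unitInterval → C2) → G}
    (h₂ : FlatOn Set.univ v₂) (hX : ρ₁ (inclStar D.e₁ (basisX D.e₁)) = v₂ (sigma1 ∘ loopX))
    (hH : ρ₁ (inclStar D.e₁ (basisH D.e₁)) = v₂ (sigma1 ∘ loopH))
    (hvert : ∀ s : unitInterval → unitInterval, Continuous s → v₂ (C2.vert ∘ s) = 1) :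
    ∃ v : (unitInterval → Y) → G, FlatOn Set.univ v ∧
      (∀ γ : Path (bdIncl Y₁ (basePt D.e₁)) (bdIncl Y₁ (basePt D.e₁)), v (D.j ∘ γ) =
        ρ₁ (FundamentalGroup.fromPath (Path.Homotopic.Quotient.mk γ))) ∧
      (∀ τ : unitInterval → Torus, Continuous τ →
        v (fun t => D.k (sigma2 (τ t))) = v₂ (sigma2 ∘ τ)) ∧
      (∀ τ : unitInterval → Torus, Continuous τ →
        v (fun t => D.k (sigma1 (τ t))) = v₂ (sigma1 ∘ τ)) ∧
      v (fun t => D.k (C2.vert t)) = 1 := by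
  classical
  have hi : Continuous fun p : Torus => (D.e₁ p : Y₁) :=
    continuous_subtype_val.comp D.e₁.continuous
  have ht := flatOn_transportOf ρ₁
  obtain ⟨f, f1, hf⟩ := FlatOn.exists_gauge_torus
    (ht.comp hi.continuousOn fun _ _ => trivial)
    (h₂.comp C2.continuous_sigma1.continuousOn fun _ _ => trivial)
    ((transportOf_path ρ₁ ((loopX.map D.e₁.continuous).map continuous_subtype_val)).trans hX)
    ((transportOf_path ρ₁ ((loopH.map D.e₁.continuous).map continuous_subtype_val)).trans hH)
  -- Equal values on x₁ and h give agreement on Σ₁' only up to the gauge `f`, which is absorbed on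
  -- the side of Y₁. Extension by 1 is allowed since a gauge need not be continuous, and f = 1 at
  -- the base point leaves ρ₁ unconjugated.
  let F : Y₁ → G := fun y => if h : y ∈ (𝓡∂ 3).boundary Y₁ then f (D.e₁.symm ⟨y, h⟩) else 1
  have hF : ∀ p, F (D.e₁ p) = f p := fun p => by
    have h : (D.e₁ p : Y₁) ∈ (𝓡∂ 3).boundary Y₁ := (D.e₁ p).2
    simp only [F, dif_pos h]
    exact congrArg f (D.e₁.symm_apply_apply p)
  have h₁ := ht.gauge F
  have hagree : ∀ τ : unitInterval → Torus, Continuous τ →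
      F (D.e₁ (τ 1)) * transportOf ρ₁ (fun t => (D.e₁ (τ t) : Y₁)) * (F (D.e₁ (τ 0)))⁻¹ =
        v₂ (sigma1 ∘ τ) := by
    intro τ hτ
    rw [hF, hF]
    exact (hf τ hτ).symm
  obtain ⟨v, hv, hvj, hvk⟩ := D.exists_flatOn_of_agree h₁ h₂ hagree
  have hj : ∀ γ : unitInterval → Y₁, Continuous γ →
      v (D.j ∘ γ) = F (γ 1) * transportOf ρ₁ γ * (F (γ 0))⁻¹ := fun γ hγ =>
    hvj (D.j ∘ γ) (D.isClosedEmbedding_j.continuous.comp hγ) (fun t => D.j_not_mem _) γ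
      fun t => D.stretch_j _
  refine ⟨v, hv, fun γ => ?_, fun τ hτ => ?_, fun τ hτ => ?_, ?_⟩
  · have hb : F (bdIncl Y₁ (basePt D.e₁)) = 1 := (hF (1, 1)).trans f1
    rw [hj γ γ.continuous, γ.source, γ.target, hb, transportOf_path]
    simp
  · refine hvk _ (D.isClosedEmbedding_k.continuous.comp (C2.continuous_sigma2.comp hτ))
      (fun t => D.k_not_mem (sigma2_not_mem_range _)) _ fun t => ?_
    simp only [Function.comp_apply, stretch_k, C2.stretch_sigma2]
  · have := hj _ (hi.comp hτ)
    rw [← hagree τ hτ]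
    refine Eq.trans ?_ this
    congr 1
    funext t
    exact (D.j_e₁ (τ t)).symm
  · let π : ℝ → unitInterval := Set.projIcc 0 1 zero_le_one
    have hπ : Continuous π := continuous_projIcc
    have hπ' : ∀ r : ℝ, r ∈ Set.Icc (0 : ℝ) 1 → (π r : ℝ) = r := fun r hr => by
      simp only [π, Set.projIcc_of_mem _ hr]
    let γ : ℝ → Y := fun r => D.k (C2.vert (π r))
    have hγ : Continuous γ :=
      D.isClosedEmbedding_k.continuous.comp (C2.continuous_vert.comp hπ)
    have e : (fun t => D.k (C2.vert t)) = γ ∘ segmentMap 0 1 := by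
      funext t
      simp [γ, π, segmentMap_zero_left]
    -- The number 7/8 lies between 3/4, the edge of the core, and 1, the height of Σ₁': the first
    -- piece avoids Y₁, and the second avoids the core and is stretched to a single point.
    have s₁ : v (γ ∘ segmentMap 0 (7 / 8)) = 1 := by
      have hmem : ∀ t, segmentMap (0 : ℝ) (7 / 8) t ∈ Set.Icc (0 : ℝ) (7 / 8) := fun t =>
        segmentMap_mem (convex_Icc _ _) (by norm_num) (by norm_num) t
      have hmem' : ∀ t, segmentMap (0 : ℝ) (7 / 8) t ∈ Set.Icc (0 : ℝ) 1 := fun t =>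
        ⟨(hmem t).1, (hmem t).2.trans (by norm_num)⟩
      rw [hvk _ (hγ.comp (continuous_segmentMap _ _)) (fun t => D.k_not_mem
        (C2.proj_not_mem_range_sigma1 (by
          change |(π (segmentMap 0 (7 / 8) t) : ℝ)| < 1
          rw [hπ' _ (hmem' t), abs_of_nonneg (hmem t).1]
          linarith [(hmem t).2])))
        (C2.vert ∘ fun t => ⟨stretchReal (π (segmentMap 0 (7 / 8) t)),
          C2.stretchReal_mem (π (segmentMap 0 (7 / 8) t)).2⟩) fun t => D.stretch_k _]
      exact hvert _ (Continuous.subtype_mk (continuous_stretchReal.comp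
        (continuous_subtype_val.comp (hπ.comp (continuous_segmentMap _ _)))) _)
    have s₂ : v (γ ∘ segmentMap (7 / 8) 1) = 1 := by
      have hmem : ∀ t, segmentMap (7 / 8 : ℝ) 1 t ∈ Set.Icc (7 / 8 : ℝ) 1 := fun t =>
        segmentMap_mem (convex_Icc _ _) (by norm_num) (by norm_num) t
      have hmem' : ∀ t, segmentMap (7 / 8 : ℝ) 1 t ∈ Set.Icc (0 : ℝ) 1 := fun t =>
        ⟨le_trans (by norm_num) (hmem t).1, (hmem t).2⟩
      rw [hvj _ (hγ.comp (continuous_segmentMap _ _)) (fun t h => by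
        obtain ⟨q, hq, h⟩ := h
        rw [D.isClosedEmbedding_k.injective h] at hq
        have := C2.mem_core_iff.1 hq
        simp only [hπ' _ (hmem' t)] at this
        rw [abs_of_nonneg (hmem' t).1] at this
        linarith [(hmem t).1]) (fun _ => (D.e₁ (C2.arc 0) : Y₁)) fun t => by
          change D.stretch (D.k (C2.vert _)) = _
          rw [D.stretch_k, D.j_e₁, ← C2.vert_one, C2.stretch_vert]
          congr 2
          ext
          simp only [hπ' _ (hmem' t)]
          rw [stretchReal_of_le (le_trans (by norm_num) (hmem t).1)]
          rfl]
      exact h₁.const (Set.mem_univ _)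
    rw [e, ← hv.interval convex_univ hγ.continuousOn (fun _ _ => trivial) (Set.mem_univ 0)
      (Set.mem_univ (7 / 8)) (Set.mem_univ 1), s₁, s₂, one_mul]

/-- The representations of `π₁(Y)` which restrict to a given representation of `π₁(Y₁)`, up to
conjugation. -/
theorem exists_hom (ρ₁ : PiM D.e₁ →* G) {X₁ W H : G}
    (hX : ρ₁ (inclStar D.e₁ (basisX D.e₁)) = X₁) (hH : ρ₁ (inclStar D.e₁ (basisH D.e₁)) = H)
    (hXH : X₁ * H = H * X₁) (hW : W * H * W⁻¹ = H⁻¹) :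
    ∃ ρ : PiM D.e₂ →* G, ρ (inclStar D.e₂ (basisX D.e₂)) = W * W * X₁⁻¹ ∧
      ρ (inclStar D.e₂ (basisH D.e₂)) = H ∧ ∀ a, X₁⁻¹ * ρ₁ a * X₁ ∈ ρ.range := by
  obtain ⟨v₂, h₂, x₁, y₁, hvert, g, x₂, y₂, hg⟩ := C2.exists_flatOn hXH hW
  obtain ⟨v, hv, hj, hk₂, hk₁, hvt⟩ := D.exists_flatOn_of_hom ρ₁ h₂ (hX.trans x₁.symm)
    (hH.trans y₁.symm) hvert
  have val : ∀ l : Path ((1, 1) : Torus) (1, 1), hv.hom (bdIncl Y (basePt D.e₂))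
      (inclStar D.e₂ (FundamentalGroup.map (D.e₂ : C(Torus, Bd Y)) (1, 1)
        (FundamentalGroup.fromPath (Path.Homotopic.Quotient.mk l)))) = v₂ (sigma2 ∘ l) := by
    intro l
    rw [← hk₂ l l.continuous]
    have : v ((l.map D.e₂.continuous).map continuous_subtype_val) =
        v (fun t => D.k (sigma2 (l t))) := congrArg v (funext fun t => D.coe_e₂ (l t))
    exact this
  refine ⟨(MulAut.conj g⁻¹).toMonoidHom.comp (hv.hom _), ?_, ?_, ?_⟩
  · change g⁻¹ * hv.hom _ _ * g⁻¹⁻¹ = _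
    rw [basisX, val, x₂]
    group
  · change g⁻¹ * hv.hom _ _ * g⁻¹⁻¹ = _
    rw [basisH, val, y₂]
    group
  · rintro ⟨γ⟩
    let c₁ : Path (bdIncl Y (basePt D.e₂)) (D.k (sigma1 (C2.arc 0))) :=
      ⟨⟨fun t => D.k (C2.vert t), D.isClosedEmbedding_k.continuous.comp C2.continuous_vert⟩,
        (congrArg D.k C2.vert_zero).trans (D.coe_e₂ (1, 1)).symm, congrArg D.k C2.vert_one⟩
    let c₂ : Path (D.k (sigma1 (C2.arc 0))) (D.j (bdIncl Y₁ (basePt D.e₁))) :=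
      ⟨⟨fun t => D.k (sigma1 (C2.arc t)), D.isClosedEmbedding_k.continuous.comp
        (C2.continuous_sigma1.comp C2.continuous_arc)⟩, rfl,
        (congrArg (fun p => D.k (sigma1 p)) C2.arc_one).trans (D.j_e₁ (1, 1)).symm⟩
    -- The path joins the base points of ∂Y and ∂Y₁. Its transport times g is X₁, which accounts for
    -- the conjugation of ρ₁ by X₁.
    have hc : v (c₁.trans c₂) * g = X₁ := by
      rw [hv.trans, show v c₁ = 1 from hvt, mul_one]
      exact (congrArg (· * g) (hk₁ _ C2.continuous_arc)).trans hg
    refine ⟨FundamentalGroup.fromPath (Path.Homotopic.Quotient.mk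
      (((c₁.trans c₂).trans (γ.map D.isClosedEmbedding_j.continuous)).trans
        (c₁.trans c₂).symm)), ?_⟩
    change g⁻¹ * hv.hom _ _ * g⁻¹⁻¹ = _
    rw [hv.hom_mk, hv.trans, hv.trans, hv.symm,
      show v (γ.map D.isClosedEmbedding_j.continuous) = _ from hj γ, ← hc]
    change _ = _ * ρ₁ (FundamentalGroup.fromPath (Path.Homotopic.Quotient.mk γ)) * _
    group

/-- The restriction to `π₁(Y₁)` of a representation of `π₁(Y)` with commuting values. -/
theorem exists_hom_of_commute (ρ : PiM D.e₂ →* G) (hρ : ∀ a b, ρ a * ρ b = ρ b * ρ a) :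
    ρ (inclStar D.e₂ (basisH D.e₂)) * ρ (inclStar D.e₂ (basisH D.e₂)) = 1 ∧
    ∃ ρ₁ : PiM D.e₁ →* G, (∀ a b, ρ₁ a * ρ₁ b = ρ₁ b * ρ₁ a) ∧
      ρ₁ (inclStar D.e₁ (basisH D.e₁)) = ρ (inclStar D.e₂ (basisH D.e₂)) := by
  have hv := flatOn_transportOf ρ
  have hc : ∀ γ γ', transportOf ρ γ * transportOf ρ γ' = transportOf ρ γ' * transportOf ρ γ := by
    intro γ γ'
    obtain ⟨a, ha⟩ := transportOf_mem_range ρ γ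
    obtain ⟨b, hb⟩ := transportOf_mem_range ρ γ'
    rw [← ha, ← hb, hρ]
  have hH : ρ (inclStar D.e₂ (basisH D.e₂)) = transportOf ρ (D.k ∘ (sigma2 ∘ loopH)) := by
    refine (transportOf_path ρ ((loopH.map D.e₂.continuous).map continuous_subtype_val)).symm.trans
      (congrArg _ (funext fun t => D.coe_e₂ (loopH t)))
  have hk := hv.comp (U := Set.univ) D.isClosedEmbedding_k.continuous.continuousOn
    fun _ _ => trivial
  have hj := hv.comp (U := Set.univ) D.isClosedEmbedding_j.continuous.continuousOn
    fun _ _ => trivial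
  obtain ⟨e₁, e₂⟩ := C2.transport_abelian hk fun γ γ' => hc _ _
  rw [hH]
  refine ⟨e₂, hj.hom _, ?_, ?_⟩
  · rintro ⟨a⟩ ⟨b⟩
    exact hc _ _
  · refine Eq.trans ?_ e₁.symm
    exact congrArg (transportOf ρ) (funext fun t => D.j_e₁ (loopH t))

end UnionC2

/-! ### Linear algebra in `SU(2)` -/

namespace SU2

open ComplexConjugate

/-- Both sides invert A. Comparing entries gives A the rows (a, -b̄) and (b, ā), so every later
identity is checked on the first column. -/
theorem star_eq_adjugate (A : SU2) : star A.1 = A.1.adjugate := by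
  have h := Matrix.mem_specialUnitaryGroup_iff.1 A.2
  have h1 : star A.1 * A.1 = 1 := Matrix.mem_unitaryGroup_iff'.1 h.1
  have h2 : A.1 * A.1.adjugate = 1 := by rw [Matrix.mul_adjugate, h.2, one_smul]
  calc star A.1 = star A.1 * (A.1 * A.1.adjugate) := by rw [h2, mul_one]
    _ = A.1.adjugate := by rw [← mul_assoc, h1, one_mul]

theorem apply_one_one (A : SU2) : A.1 1 1 = conj (A.1 0 0) := by
  have := congrFun (congrFun (star_eq_adjugate A) 0) 0
  simpa [Matrix.adjugate_fin_two, Matrix.star_apply] using this.symm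

theorem apply_zero_one (A : SU2) : A.1 0 1 = -conj (A.1 1 0) := by
  have := congrFun (congrFun (star_eq_adjugate A) 0) 1
  simp [Matrix.adjugate_fin_two, Matrix.star_apply] at this
  rw [this, neg_neg]

theorem norm_eq (A : SU2) : A.1 0 0 * conj (A.1 0 0) + A.1 1 0 * conj (A.1 1 0) = 1 := by
  have h := (Matrix.mem_specialUnitaryGroup_iff.1 A.2).2
  rw [Matrix.det_fin_two, apply_one_one, apply_zero_one] at h
  rw [← h]
  ring

/-- Two elements of `SU(2)` with the same first column are equal. -/
theorem ext {A B : SU2} (h0 : A.1 0 0 = B.1 0 0) (h1 : A.1 1 0 = B.1 1 0) : A = B := by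
  apply Subtype.ext
  ext i j
  fin_cases i <;> fin_cases j
  · exact h0
  · change A.1 0 1 = B.1 0 1
    rw [apply_zero_one, apply_zero_one, h1]
  · exact h1
  · change A.1 1 1 = B.1 1 1
    rw [apply_one_one, apply_one_one, h0]

/-- The element of `SU(2)` with first column `(a, b)`. -/
def mk (a b : ℂ) (h : a * conj a + b * conj b = 1) : SU2 :=
  ⟨!![a, -conj b; b, conj a], by
    rw [Matrix.mem_specialUnitaryGroup_iff]
    refine ⟨?_, ?_⟩
    · rw [Matrix.mem_unitaryGroup_iff']
      ext i j
      fin_cases i <;> fin_cases j <;>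
        simp [Matrix.mul_apply, Fin.sum_univ_two, Matrix.star_apply]
      · rw [← h]; ring
      · ring
      · ring
      · rw [← h]; ring
    · rw [Matrix.det_fin_two_of, ← h]
      ring⟩

@[simp] theorem mk_zero_zero {a b : ℂ} (h) : (mk a b h).1 0 0 = a := rfl

@[simp] theorem mk_one_zero {a b : ℂ} (h) : (mk a b h).1 1 0 = b := rfl

theorem mul_zero_zero (A B : SU2) :
    (A * B).1 0 0 = A.1 0 0 * B.1 0 0 - conj (A.1 1 0) * B.1 1 0 := by
  change (A.1 * B.1) 0 0 = _
  rw [Matrix.mul_apply, Fin.sum_univ_two, apply_zero_one]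
  ring

theorem mul_one_zero (A B : SU2) :
    (A * B).1 1 0 = A.1 1 0 * B.1 0 0 + conj (A.1 0 0) * B.1 1 0 := by
  change (A.1 * B.1) 1 0 = _
  rw [Matrix.mul_apply, Fin.sum_univ_two, apply_one_one]

theorem inv_zero_zero (A : SU2) : (A⁻¹).1 0 0 = conj (A.1 0 0) := by
  change (star A.1) 0 0 = _
  rw [Matrix.star_apply]
  rfl

theorem inv_one_zero (A : SU2) : (A⁻¹).1 1 0 = -A.1 1 0 := by
  change (star A.1) 1 0 = _
  rw [Matrix.star_apply, apply_zero_one, star_neg]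
  simp

theorem mem_U1_iff {A : SU2} : A ∈ U1 ↔ A.1 1 0 = 0 := by
  constructor
  · intro h
    exact h (by decide)
  · intro h i j hij
    fin_cases i <;> fin_cases j
    · exact (hij rfl).elim
    · change A.1 0 1 = 0
      rw [apply_zero_one, h, map_zero, neg_zero]
    · exact h
    · exact (hij rfl).elim

/-- By Cayley–Hamilton (1 + A)² = (2 + tr A) A, so (1 + A) / √(2 + tr A) is a root unless A = -1; in
that case diag(i, -i) is one. -/
theorem exists_sqrt (A : SU2) : ∃ Z : SU2, Z * Z = A := by
  have hn := norm_eq A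
  set a := A.1 0 0 with ha
  set b := A.1 1 0 with hb
  by_cases h : a = -1
  · have hb0 : b = 0 := by
      rw [h] at hn
      simpa using hn
    refine ⟨mk Complex.I 0 (by simp), ext ?_ ?_⟩
    · rw [mul_zero_zero, ← ha, h]
      simp
    · rw [mul_one_zero, ← hb, hb0]
      simp
  have hre : 0 < 2 + 2 * a.re := by
    have h1 : a.re * a.re + a.im * a.im + (b.re * b.re + b.im * b.im) = 1 := by
      have := congrArg Complex.re hn
      simp at this
      linarith
    by_contra hle
    have i1 := mul_self_nonneg a.im
    have i2 := mul_self_nonneg b.re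
    have i3 := mul_self_nonneg b.im
    have h2 : a.re = -1 := by nlinarith
    have h3 : a.im = 0 := by
      rw [h2] at h1
      exact mul_self_eq_zero.1 (by linarith)
    exact h (Complex.ext (by simpa using h2) (by simpa using h3))
  obtain ⟨c, hc0, hc⟩ : ∃ c : ℝ, c ≠ 0 ∧ (c : ℂ) * c = 2 + a + conj a := by
    refine ⟨√(2 + 2 * a.re), (Real.sqrt_pos.2 hre).ne', ?_⟩
    rw [← Complex.ofReal_mul, Real.mul_self_sqrt hre.le, add_assoc, Complex.add_conj]
    push_cast
    ring
  have hc' : (c : ℂ) ≠ 0 := Complex.ofReal_ne_zero.2 hc0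
  refine ⟨mk ((1 + a) / c) (b / c) ?_, ext ?_ ?_⟩
  · simp only [map_div₀, map_add, map_one, Complex.conj_ofReal]
    field_simp
    linear_combination hn - hc
  · rw [mul_zero_zero, ← ha]
    simp only [mk_zero_zero, mk_one_zero, map_div₀, Complex.conj_ofReal]
    field_simp
    linear_combination -a * hc - hn
  · rw [mul_one_zero, ← hb]
    simp only [mk_zero_zero, mk_one_zero, map_div₀, map_add, map_one, Complex.conj_ofReal]
    field_simp
    linear_combination -b * hc

/-- The diagonal entries of A are distinct, so its centralizer is diagonal. -/
theorem mem_U1_of_commute {A B : SU2} (hA : A ∈ U1) (hA' : A.1 0 0 ≠ conj (A.1 0 0))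
    (h : A * B = B * A) : B ∈ U1 := by
  rw [mem_U1_iff] at *
  have := congrArg (fun M : SU2 => M.1 1 0) h
  simp only [mul_one_zero, hA, zero_mul, zero_add, mul_zero, add_zero] at this
  have h2 : (A.1 0 0 - conj (A.1 0 0)) * B.1 1 0 = 0 := by linear_combination -this
  exact (mul_eq_zero.1 h2).resolve_left (sub_ne_zero.2 hA')

/-- The first column of P is a normalized eigenvector of A. -/
theorem exists_conj_mem_U1 (A : SU2) : ∃ P : SU2, P⁻¹ * A * P ∈ U1 := by
  obtain ⟨μ, hμ⟩ := Module.End.exists_eigenvalue (Matrix.toLin' A.1)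
  obtain ⟨x, hx⟩ := hμ.exists_hasEigenvector
  have hx0 := hx.2
  have hx1 : A.1.mulVec x = μ • x := by simpa using hx.apply_eq_smul
  have e0 : A.1 0 0 * x 0 + A.1 0 1 * x 1 = μ * x 0 := by
    simpa [Matrix.mulVec, dotProduct, Fin.sum_univ_two] using congrFun hx1 0
  have e1 : A.1 1 0 * x 0 + A.1 1 1 * x 1 = μ * x 1 := by
    simpa [Matrix.mulVec, dotProduct, Fin.sum_univ_two] using congrFun hx1 1
  rw [apply_zero_one] at e0
  rw [apply_one_one] at e1
  have hpos : 0 < Complex.normSq (x 0) + Complex.normSq (x 1) := by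
    by_contra hle
    have h0 := Complex.normSq_nonneg (x 0)
    have h1 := Complex.normSq_nonneg (x 1)
    apply hx0
    ext i
    fin_cases i
    · change x 0 = 0
      exact Complex.normSq_eq_zero.1 (by linarith)
    · change x 1 = 0
      exact Complex.normSq_eq_zero.1 (by linarith)
  obtain ⟨c, hc0, hc⟩ : ∃ c : ℝ, c ≠ 0 ∧ (c : ℂ) * c = x 0 * conj (x 0) + x 1 * conj (x 1) := by
    refine ⟨√(Complex.normSq (x 0) + Complex.normSq (x 1)), (Real.sqrt_pos.2 hpos).ne', ?_⟩
    rw [← Complex.ofReal_mul, Real.mul_self_sqrt hpos.le, Complex.mul_conj, Complex.mul_conj]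
    push_cast
    ring
  have hc' : (c : ℂ) ≠ 0 := Complex.ofReal_ne_zero.2 hc0
  refine ⟨mk (x 0 / c) (x 1 / c) ?_, mem_U1_iff.2 ?_⟩
  · simp only [map_div₀, Complex.conj_ofReal]
    field_simp
    linear_combination -hc
  · rw [mul_assoc, mul_one_zero, mul_zero_zero, mul_one_zero, inv_one_zero, inv_zero_zero]
    simp only [mk_zero_zero, mk_one_zero, Complex.conj_conj]
    field_simp
    linear_combination x 0 * e1 - x 1 * e0

/-- A commuting family in `SU(2)` is simultaneously conjugate into `U(1)`. -/
theorem exists_conj_mem_U1_of_commute {ι : Type*} (A : ι → SU2)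
    (h : ∀ i j, A i * A j = A j * A i) : ∃ P : SU2, ∀ i, P⁻¹ * A i * P ∈ U1 := by
  by_cases hU : ∀ i, A i ∈ U1
  · exact ⟨1, fun i => by simpa using hU i⟩
  push Not at hU
  obtain ⟨i, hi⟩ := hU
  obtain ⟨P, hP⟩ := exists_conj_mem_U1 (A i)
  -- An `A i` outside U(1) is not scalar, so its diagonal form has distinct entries and forces the
  -- whole family to be diagonal.
  refine ⟨P, fun j => mem_U1_of_commute hP ?_ ?_⟩
  · intro hs
    apply hi
    obtain ⟨B, hB⟩ : ∃ B, B = P⁻¹ * A i * P := ⟨_, rfl⟩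
    rw [← hB] at hP hs
    have hB0 : B.1 1 0 = 0 := mem_U1_iff.1 hP
    have e : A i = P * B * P⁻¹ := by rw [hB]; group
    rw [e, mem_U1_iff, mul_one_zero, mul_one_zero, mul_zero_zero, inv_one_zero, inv_zero_zero,
      hB0, map_sub, map_mul, map_mul, ← hs]
    simp
    ring
  · rw [show P⁻¹ * A i * P * (P⁻¹ * A j * P) = P⁻¹ * (A i * A j) * P by group, h i j]
    group

end SU2

/-! ### The group `U(1)` -/

namespace U1

theorem ext {A B : U1} (h : A.1.1 0 0 = B.1.1 0 0) : A = B :=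
  Subtype.ext (SU2.ext h ((SU2.mem_U1_iff.1 A.2).trans (SU2.mem_U1_iff.1 B.2).symm))

theorem mul_apply (A B : U1) : (A * B).1.1 0 0 = A.1.1 0 0 * B.1.1 0 0 := by
  change (A.1 * B.1).1 0 0 = _
  rw [SU2.mul_zero_zero, SU2.mem_U1_iff.1 A.2, map_zero, zero_mul, sub_zero]

theorem mul_comm (A B : U1) : A * B = B * A :=
  ext (by rw [mul_apply, mul_apply, _root_.mul_comm])

theorem expU1_apply (θ : ℝ) : (expU1 θ).1.1 0 0 = (Circle.exp θ : ℂ) := rfl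

theorem expU1_add (a b : ℝ) : expU1 (a + b) = expU1 a * expU1 b :=
  ext (by rw [mul_apply, expU1_apply, expU1_apply, expU1_apply, Circle.exp_add, Circle.coe_mul])

theorem expU1_zero : expU1 0 = 1 :=
  ext (by rw [expU1_apply, Circle.exp_zero]; rfl)

theorem expU1_neg (a : ℝ) : expU1 (-a) = (expU1 a)⁻¹ :=
  eq_inv_of_mul_eq_one_left (by rw [← expU1_add, neg_add_cancel, expU1_zero])

theorem expU1_surjective : Function.Surjective expU1 := by
  intro A
  have h := SU2.norm_eq A.1
  rw [SU2.mem_U1_iff.1 A.2, zero_mul, add_zero, Complex.mul_conj] at h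
  have h1 : Complex.normSq (A.1.1 0 0) = 1 := by exact_mod_cast h
  obtain ⟨z, hz⟩ : ∃ z : Circle, (z : ℂ) = A.1.1 0 0 :=
    ⟨⟨_, mem_sphere_zero_iff_norm.2 (by rw [Complex.norm_def, h1, Real.sqrt_one])⟩, rfl⟩
  exact ⟨(z : ℂ).arg, ext (by rw [expU1_apply, Circle.exp_arg, hz])⟩

theorem expU1_pi_apply : (expU1 Real.pi).1.1 0 0 = -1 := by
  rw [expU1_apply, Circle.coe_exp, Complex.exp_pi_mul_I]

theorem expU1_eq_one_iff {θ : ℝ} : expU1 θ = 1 ↔ ∃ n : ℤ, θ = n * (2 * Real.pi) := by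
  constructor
  · intro h
    have h1 : Circle.exp θ = Circle.exp 0 := by
      rw [Circle.exp_zero]
      exact Circle.ext (congrArg (fun A : U1 => A.1.1 0 0) h)
    simpa using Circle.exp_eq_exp.1 h1
  · rintro ⟨n, rfl⟩
    rw [← expU1_zero]
    apply ext
    rw [expU1_apply, expU1_apply, Circle.exp_eq_exp.2 ⟨n, (zero_add _).symm⟩]

theorem expU1_pi_mul_self : expU1 Real.pi * expU1 Real.pi = 1 := by
  rw [← expU1_add]
  exact expU1_eq_one_iff.2 ⟨1, by push_cast; ring⟩

theorem eq_of_real {A : U1} (h : A.1.1 0 0 = starRingEnd ℂ (A.1.1 0 0)) :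
    A = expU1 0 ∨ A = expU1 Real.pi := by
  have h1 := SU2.norm_eq A.1
  rw [SU2.mem_U1_iff.1 A.2, zero_mul, add_zero, ← h] at h1
  rcases mul_self_eq_one_iff.1 h1 with h1 | h1
  · exact Or.inl (ext (by rw [h1, expU1_zero]; rfl))
  · exact Or.inr (ext (by rw [h1, expU1_pi_apply]))

theorem eq_of_mul_self {A : U1} (h : A * A = 1) : A = expU1 0 ∨ A = expU1 Real.pi := by
  have h1 : A.1.1 0 0 * A.1.1 0 0 = 1 := by
    rw [← mul_apply, h]; rfl
  refine eq_of_real ?_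
  rcases mul_self_eq_one_iff.1 h1 with h1 | h1 <;> simp [h1]

/-- The elements `±1` of `U(1)` are central in `SU(2)`. -/
theorem central_of_real {A : U1} (h : A.1.1 0 0 = starRingEnd ℂ (A.1.1 0 0)) (B : SU2) :
    A.1 * B = B * A.1 := by
  have h0 := SU2.mem_U1_iff.1 A.2
  apply SU2.ext
  · rw [SU2.mul_zero_zero, SU2.mul_zero_zero, h0, map_zero]
    ring
  · rw [SU2.mul_one_zero, SU2.mul_one_zero, h0, ← h]
    ring

end U1

/-- `e^{iε}` for `ε ∈ {0, π}` has the real entry `±1`. -/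
theorem expU1_real {ε : ℝ} (hε : ε = 0 ∨ ε = Real.pi) :
    (expU1 ε).1.1 0 0 = starRingEnd ℂ ((expU1 ε).1.1 0 0) := by
  rcases hε with rfl | rfl
  · rw [U1.expU1_apply, Circle.exp_zero]; simp
  · rw [U1.expU1_pi_apply]; simp

theorem expU1_mul_self {ε : ℝ} (hε : ε = 0 ∨ ε = Real.pi) : expU1 ε * expU1 ε = 1 := by
  rcases hε with rfl | rfl
  · rw [U1.expU1_zero, one_mul]
  · exact U1.expU1_pi_mul_self

/-! ### Extensions -/

section Representations

variable {M : Type*} [TopologicalSpace M] [ChartedSpace (EuclideanHalfSpace 3) M]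

theorem piBd_hom_ext {G : Type*} [Group G] {e : Torus ≃ₜ Bd M} {φ φ' : PiBd e →* G}
    (hX : φ (basisX e) = φ' (basisX e)) (hH : φ (basisH e) = φ' (basisH e)) : φ = φ' := by
  have h : φ.comp (FundamentalGroup.map (e : C(Torus, Bd M)) (1, 1)) =
      φ'.comp (FundamentalGroup.map (e : C(Torus, Bd M)) (1, 1)) :=
    fundamentalGroup_torus_hom_ext hX hH
  refine MonoidHom.ext ?_
  rintro ⟨γ⟩
  let δ : Path ((1, 1) : Torus) (1, 1) :=
    ⟨⟨fun t => e.symm (γ t), e.symm.continuous.comp γ.continuous⟩,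
      (congrArg e.symm γ.source).trans (e.symm_apply_apply _),
      (congrArg e.symm γ.target).trans (e.symm_apply_apply _)⟩
  have hδ : δ.map e.continuous = γ := by
    ext1
    funext t
    exact e.apply_symm_apply (γ t)
  have := DFunLike.congr_fun h (FundamentalGroup.fromPath (Path.Homotopic.Quotient.mk δ))
  change φ (FundamentalGroup.fromPath (Path.Homotopic.Quotient.mk (δ.map e.continuous))) =
    φ' (FundamentalGroup.fromPath (Path.Homotopic.Quotient.mk (δ.map e.continuous))) at this
  rw [hδ] at this
  exact this

theorem extends_of_basis {e : Torus ≃ₜ Bd M} {ρ : RM e} {η : RBd e}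
    (hX : ρ (inclStar e (basisX e)) = (η (basisX e) : SU2))
    (hH : ρ (inclStar e (basisH e)) = (η (basisH e) : SU2)) : Extends ρ η := by
  have : ρ.comp (inclStar e) = (U1.subtype).comp η := piBd_hom_ext hX hH
  exact fun γ => DFunLike.congr_fun this γ

theorem TSet_eq (e : Torus ≃ₜ Bd M) : TSet e = ASet e ∪ HSet e := by
  ext η
  constructor
  · rintro ⟨ρ, hρ⟩
    by_cases h : IsAbelianRep ρ
    · exact Or.inl ⟨ρ, hρ, h⟩
    · exact Or.inr ⟨ρ, hρ, h⟩
  · rintro (⟨ρ, hρ, -⟩ | ⟨ρ, hρ, -⟩) <;> exact ⟨ρ, hρ⟩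

/-- An abelian representation is conjugate to a representation in `U(1)`. -/
theorem exists_conj_hom_U1 {e : Torus ≃ₜ Bd M} {ρ : RM e} (hρ : IsAbelianRep ρ) :
    ∃ (P : SU2) (σ : PiM e →* U1), ∀ a, (σ a : SU2) = P⁻¹ * ρ a * P := by
  obtain ⟨P, hP⟩ := SU2.exists_conj_mem_U1_of_commute ρ hρ
  refine ⟨P, ((MulAut.conj P⁻¹).toMonoidHom.comp ρ).codRestrict U1 fun a => ?_, fun a => ?_⟩
  · change P⁻¹ * ρ a * P⁻¹⁻¹ ∈ U1
    rw [inv_inv]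
    exact hP a
  · change P⁻¹ * ρ a * P⁻¹⁻¹ = _
    rw [inv_inv]

end Representations

/-! ### The theorem -/

namespace UnionC2

variable {Y₁ Y : Type*} [TopologicalSpace Y₁] [ChartedSpace (EuclideanHalfSpace 3) Y₁]
  [TopologicalSpace Y] [ChartedSpace (EuclideanHalfSpace 3) Y] (D : UnionC2 Y₁ Y)

theorem extends_mem_ASet {e : Torus ≃ₜ Bd Y} {η : RBd e} (ρ : PiM e →* U1)
    (hX : ρ (inclStar e (basisX e)) = η (basisX e))
    (hH : ρ (inclStar e (basisH e)) = η (basisH e)) : η ∈ ASet e :=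
  ⟨U1.subtype.comp ρ, extends_of_basis (congrArg Subtype.val hX) (congrArg Subtype.val hH),
    fun a b => congrArg Subtype.val (U1.mul_comm (ρ a) (ρ b))⟩

/-- A representation of `π₁(Y₁)` in `U(1)` with `h ↦ e^{iε}`, `ε ∈ {0, π}`, makes all points of
the line `{ψ₂ = ε}` abelian. -/
theorem psiLine_subset_ASet {ε : ℝ} (hε : ε = 0 ∨ ε = Real.pi) (σ : PiM D.e₁ →* U1)
    (hσ : σ (inclStar D.e₁ (basisH D.e₁)) = expU1 ε) : psiLine D.e₂ ε ⊆ ASet D.e₂ := by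
  rintro η ⟨θ, hx, hh⟩
  obtain ⟨θ₁, h₁⟩ := U1.expU1_surjective (σ (inclStar D.e₁ (basisX D.e₁)))
  -- Since H = H⁻¹, any W in U(1) is admissible, and this angle gives W² X₁⁻¹ = e^{iθ}. Gluing
  -- inside U(1) keeps the result abelian.
  obtain ⟨ρ, h₂, h₃, -⟩ := D.exists_hom σ (W := expU1 ((θ + θ₁) / 2)) h₁.symm hσ
    (U1.mul_comm _ _) (by
      rw [U1.mul_comm, inv_mul_cancel_left]
      exact eq_inv_of_mul_eq_one_left (expU1_mul_self hε))
  refine extends_mem_ASet ρ ?_ (h₃.trans hh.symm)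
  rw [h₂, hx, ← U1.expU1_neg, ← U1.expU1_add, ← U1.expU1_add]
  congr 1
  ring

/-- H² = 1 leaves H = ±1. If H = -1, conjugating the restriction to Y₁ into U(1) does not move this
central value. -/
theorem mem_psiLine_of_mem_ASet {η : RBd D.e₂} (hη : η ∈ ASet D.e₂) :
    η ∈ psiLine D.e₂ 0 ∨
      (η ∈ psiLine D.e₂ Real.pi ∧ (ASet D.e₁ ∩ psiLine D.e₁ Real.pi).Nonempty) := by
  obtain ⟨ρ, hρ, hab⟩ := hη
  obtain ⟨hsq, ρ₁, hab₁, h₁⟩ := D.exists_hom_of_commute ρ hab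
  obtain ⟨θ, hθ⟩ := U1.expU1_surjective (η (basisX D.e₂))
  rw [hρ] at hsq h₁
  rcases U1.eq_of_mul_self (A := η (basisH D.e₂)) (Subtype.ext hsq) with h | h
  · exact Or.inl ⟨θ, hθ.symm, h⟩
  · refine Or.inr ⟨⟨θ, hθ.symm, h⟩, ?_⟩
    obtain ⟨P, σ, hσ⟩ := exists_conj_hom_U1 (ρ := ρ₁) hab₁
    obtain ⟨θ₁, hθ₁⟩ := U1.expU1_surjective (σ (inclStar D.e₁ (basisX D.e₁)))
    refine ⟨σ.comp (inclStar D.e₁), extends_mem_ASet σ rfl rfl, θ₁, hθ₁.symm, ?_⟩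
    apply Subtype.ext
    change (σ (inclStar D.e₁ (basisH D.e₁)) : SU2) = _
    rw [hσ, h₁, h, mul_assoc, U1.central_of_real (expU1_real (Or.inr rfl)) P, inv_mul_cancel_left]

/-- W is the quaternion j: it inverts U(1) and has square -1, the source of the shift by π. An
abelian representation would have H² = 1, that is ψ₁ ∈ πℤ. -/
theorem Ht_subset : D.Ht ⊆ HSet D.e₂ := by
  rintro η ⟨η₁, ⟨ρ₁, hρ₁⟩, θ₁, ψ₁, ⟨hx₁, hh₁⟩, hψ, hx, hh⟩
  have h0 : (expU1 ψ₁).1.1 1 0 = 0 := SU2.mem_U1_iff.1 (expU1 ψ₁).2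
  let W : SU2 := SU2.mk 0 1 (by simp)
  have hWW : W * W = (expU1 Real.pi : SU2) := by
    apply SU2.ext
    · rw [SU2.mul_zero_zero, U1.expU1_pi_apply]
      simp [W]
    · rw [SU2.mul_one_zero, SU2.mem_U1_iff.1 (expU1 Real.pi).2]
      simp [W]
  have hWH : W * (expU1 ψ₁ : SU2) * W⁻¹ = (expU1 ψ₁ : SU2)⁻¹ := by
    rw [mul_inv_eq_iff_eq_mul]
    apply SU2.ext
    · rw [SU2.mul_zero_zero, SU2.mul_zero_zero, SU2.inv_one_zero, h0]
      simp [W]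
    · rw [SU2.mul_one_zero, SU2.mul_one_zero, SU2.inv_one_zero, SU2.inv_zero_zero, h0]
      simp [W]
  obtain ⟨ρ, hρx, hρh, -⟩ := D.exists_hom ρ₁ (W := W)
    ((hρ₁ _).trans (congrArg Subtype.val hx₁)) ((hρ₁ _).trans (congrArg Subtype.val hh₁))
    (congrArg Subtype.val (U1.mul_comm (expU1 θ₁) (expU1 ψ₁))) hWH
  refine ⟨ρ, extends_of_basis ?_ ?_, fun hab => ?_⟩
  · rw [hρx, hWW, hx, U1.expU1_add, U1.expU1_neg, U1.mul_comm]
    rfl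
  · rw [hρh, hh]
  · obtain ⟨hsq, -⟩ := D.exists_hom_of_commute ρ hab
    rw [hρh] at hsq
    have h1 : expU1 ψ₁ * expU1 ψ₁ = 1 := Subtype.ext hsq
    rw [← U1.expU1_add] at h1
    obtain ⟨n, hn⟩ := U1.expU1_eq_one_iff.1 h1
    exact hψ n (by linarith)

/-- H = ±1 is central, so a diagonal W reaches any θ; irreducibility is inherited from the conjugate
of ρ₁ inside the image. -/
theorem psiLine_subset_HSet {ε : ℝ} (hε : ε = 0 ∨ ε = Real.pi)
    (h : (HSet D.e₁ ∩ psiLine D.e₁ ε).Nonempty) : psiLine D.e₂ ε ⊆ HSet D.e₂ := by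
  obtain ⟨η₁, ⟨ρ₁, hρ₁, hna⟩, θ₁, hx₁, hh₁⟩ := h
  rintro η ⟨θ, hx, hh⟩
  have hc := U1.central_of_real (expU1_real hε)
  obtain ⟨ρ, hρx, hρh, hr⟩ := D.exists_hom ρ₁ (W := (expU1 ((θ + θ₁) / 2) : SU2))
    ((hρ₁ _).trans (congrArg Subtype.val hx₁)) ((hρ₁ _).trans (congrArg Subtype.val hh₁))
    (hc _).symm (by
      rw [← hc, mul_inv_cancel_right]
      exact eq_inv_of_mul_eq_one_left (congrArg Subtype.val (expU1_mul_self hε)))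
  refine ⟨ρ, extends_of_basis ?_ ?_, fun hab => hna fun a b => ?_⟩
  · rw [hρx, hx]
    have : expU1 ((θ + θ₁) / 2) * expU1 ((θ + θ₁) / 2) * (expU1 θ₁)⁻¹ = expU1 θ := by
      rw [← U1.expU1_neg, ← U1.expU1_add, ← U1.expU1_add]
      congr 1
      ring
    exact congrArg Subtype.val this
  · rw [hρh, hh]
  · obtain ⟨a', ha⟩ := hr a
    obtain ⟨b', hb⟩ := hr b
    have := hab a' b'
    rw [ha, hb] at this
    simp only [mul_assoc, mul_inv_cancel_left, mul_right_inj] at this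
    simpa only [← mul_assoc, mul_left_inj] using this

/-- Irreducibility must come from the gluing here. As e^{iθ₁} and e^{iθ} are not ±1, x₂ can be sent
to a conjugate X₂ of e^{iθ} not commuting with X₁; W is then a square root of X₂ X₁. -/
theorem psiLine_diff_corners_subset_HSet {ε : ℝ} (hε : ε = 0 ∨ ε = Real.pi)
    (h : (TSet D.e₁ ∩ (psiLine D.e₁ ε \ corners D.e₁)).Nonempty) :
    psiLine D.e₂ ε \ corners D.e₂ ⊆ HSet D.e₂ := by
  obtain ⟨η₁, ⟨ρ₁, hρ₁⟩, ⟨θ₁, hx₁, hh₁⟩, hn₁⟩ := h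
  rintro η ⟨⟨θ, hx, hh⟩, hn⟩
  have hc := U1.central_of_real (expU1_real hε)
  have hr₁ : (expU1 θ₁).1.1 0 0 ≠ starRingEnd ℂ ((expU1 θ₁).1.1 0 0) := fun h => by
    rcases U1.eq_of_real h with h | h
    · exact hn₁ ⟨0, ε, Or.inl rfl, hε, hx₁.trans h, hh₁⟩
    · exact hn₁ ⟨Real.pi, ε, Or.inr rfl, hε, hx₁.trans h, hh₁⟩
  have hr₂ : (expU1 θ).1.1 0 0 ≠ starRingEnd ℂ ((expU1 θ).1.1 0 0) := fun h => by
    rcases U1.eq_of_real h with h | h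
    · exact hn ⟨0, ε, Or.inl rfl, hε, hx.trans h, hh⟩
    · exact hn ⟨Real.pi, ε, Or.inr rfl, hε, hx.trans h, hh⟩
  -- Any P with both entries nonzero and real would do: the lower left entry of P e^{iθ} P⁻¹ is
  -- (12/25)(e^{iθ} - e^{-iθ}) ≠ 0.
  let P : SU2 := SU2.mk (3 / 5) (4 / 5) (by simp only [map_div₀, map_ofNat]; norm_num)
  let X₁ : SU2 := expU1 θ₁
  let X₂ : SU2 := P * (expU1 θ : SU2) * P⁻¹
  obtain ⟨W, hW⟩ := SU2.exists_sqrt (X₂ * X₁)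
  obtain ⟨ρ, hρx, hρh, hr⟩ := D.exists_hom ρ₁ (W := W) (X₁ := X₁)
    ((hρ₁ _).trans (congrArg Subtype.val hx₁)) ((hρ₁ _).trans (congrArg Subtype.val hh₁))
    (hc _).symm (by
      rw [← hc, mul_inv_cancel_right]
      exact eq_inv_of_mul_eq_one_left (congrArg Subtype.val (expU1_mul_self hε)))
  rw [hW, mul_inv_cancel_right] at hρx
  -- Conjugating back by P brings x₂ to e^{iθ} and leaves the central value of h alone.
  refine ⟨(MulAut.conj P⁻¹).toMonoidHom.comp ρ, extends_of_basis ?_ ?_, fun hab => ?_⟩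
  · change P⁻¹ * ρ _ * P⁻¹⁻¹ = _
    rw [hρx, hx]
    simp only [X₂]
    group
  · change P⁻¹ * ρ _ * P⁻¹⁻¹ = _
    rw [hρh, hh, ← hc, inv_inv, inv_mul_cancel_right]
  · have hab' : ∀ a b, ρ a * ρ b = ρ b * ρ a := by
      intro a b
      have : P⁻¹ * ρ a * P⁻¹⁻¹ * (P⁻¹ * ρ b * P⁻¹⁻¹) = P⁻¹ * ρ b * P⁻¹⁻¹ * (P⁻¹ * ρ a * P⁻¹⁻¹) :=
        hab a b
      simp only [mul_assoc, inv_inv, mul_inv_cancel_left, mul_right_inj] at this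
      simpa only [← mul_assoc, mul_left_inj] using this
    -- The image contains X₁ itself, since X₁ commutes with the conjugating element X₁.
    obtain ⟨c, hcx⟩ := hr (inclStar D.e₁ (basisX D.e₁))
    rw [show ρ₁ (inclStar D.e₁ (basisX D.e₁)) = X₁ from
      (hρ₁ _).trans (congrArg Subtype.val hx₁), inv_mul_cancel, one_mul] at hcx
    have hcomm := hab' c (inclStar D.e₂ (basisX D.e₂))
    rw [hcx, hρx] at hcomm
    have hU := SU2.mem_U1_iff.1 (SU2.mem_U1_of_commute (expU1 θ₁).2 hr₁ hcomm)
    simp only [X₂, SU2.mul_one_zero, SU2.mul_zero_zero, SU2.inv_zero_zero, SU2.inv_one_zero,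
      SU2.mem_U1_iff.1 (expU1 θ).2, P, SU2.mk_zero_zero, SU2.mk_one_zero] at hU
    apply hr₂
    simp [map_div₀, map_ofNat] at hU
    linear_combination (25 / 12 : ℂ) * hU

theorem Heps_subset {ε : ℝ} (hε : ε = 0 ∨ ε = Real.pi) : D.Heps ε ⊆ HSet D.e₂ := by
  unfold Heps
  split_ifs with h₁ h₂
  · exact D.psiLine_subset_HSet hε h₁
  · exact D.psiLine_diff_corners_subset_HSet hε h₂
  · exact Set.empty_subset _

end UnionC2

theorem mainTheorem6 {Y₁ Y : Type*}
    [TopologicalSpace Y₁] [T2Space Y₁] [SecondCountableTopology Y₁] [ConnectedSpace Y₁]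
    [ChartedSpace (EuclideanHalfSpace 3) Y₁]
    [TopologicalSpace Y] [T2Space Y] [SecondCountableTopology Y]
    [ChartedSpace (EuclideanHalfSpace 3) Y]
    (D : UnionC2 Y₁ Y) :
    TSet D.e₂ = ASet D.e₂ ∪ HSet D.e₂ ∧
    (ASet D.e₁ ∩ psiLine D.e₁ Real.pi = ∅ → ASet D.e₂ = psiLine D.e₂ 0) ∧
    (ASet D.e₁ ∩ psiLine D.e₁ Real.pi ≠ ∅ →
      ASet D.e₂ = psiLine D.e₂ 0 ∪ psiLine D.e₂ Real.pi) ∧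
    D.Ht ∪ D.Heps 0 ∪ D.Heps Real.pi ⊆ HSet D.e₂ := by
  have h0 : psiLine D.e₂ 0 ⊆ ASet D.e₂ :=
    -- The trivial representation of π₁(Y₁) sends h to e^{i0}, so the line ψ₂ = 0 is always abelian.
    D.psiLine_subset_ASet (Or.inl rfl) 1 U1.expU1_zero.symm
  refine ⟨TSet_eq D.e₂, fun h => Set.Subset.antisymm (fun η hη => ?_) h0, fun h =>
    Set.Subset.antisymm (fun η hη => ?_) (Set.union_subset h0 ?_),
    Set.union_subset (Set.union_subset D.Ht_subset (D.Heps_subset (Or.inl rfl)))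
      (D.Heps_subset (Or.inr rfl))⟩
  · rcases D.mem_psiLine_of_mem_ASet hη with h' | h'
    · exact h'
    · exact (h'.2.ne_empty h).elim
  · exact (D.mem_psiLine_of_mem_ASet hη).imp id And.left
  · obtain ⟨η₁, ⟨ρ₁, hρ₁, hab⟩, θ₁, -, hh₁⟩ := Set.nonempty_iff_ne_empty.2 h
    obtain ⟨P, σ, hσ⟩ := exists_conj_hom_U1 hab
    refine D.psiLine_subset_ASet (Or.inr rfl) σ (Subtype.ext ?_)
    rw [hσ, hρ₁, hh₁, mul_assoc, U1.central_of_real (expU1_real (Or.inr rfl)) P,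
      inv_mul_cancel_left]

end
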